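/- Let $d\ge 0$ be an integer and let $\mathbb G=\mathbb Z^d$, with $\nu$ the counting measure, or $\mathbb G=\mathbb R^d$, with $\nu$ the Lebesgue measure. Put $F_n=[0,n]^d\subset\mathbb G$, and for $S\subset\mathbb G$ let $\overline D(S)=\limsup_{n\to\infty}\nu(S\cap F_n)/\nu(F_n)$ be its upper density. Let $X$ be a compact metric space with metric $d_X$, let $T=\{T^j:j\in\mathbb G\}$ be a continuous action of $\mathbb G$ on $X$, and let $\mu$ be an ergodic $T$-invariant Borel probability measure on $X$ (every Borel set invariant under all $T^j$ has measure $0$ or $1$). For $x,y\in X$ and $f\in L^2(X,\mu)$ (complex-valued) define $$d_b(x,y)=\limsup_{n\to\infty}\frac1{\nu(F_n)}\int_{F_n}d_X(T^jx,T^jy)\,d\nu(j),$$ $$\rho_f(x,y)=\inf\bigl\{\varepsilon>0:\ \overline D\{j\in\mathbb G:\ |f(T^jx)-f(T^jy)|>\varepsilon\}<\varepsilon\bigr\}.$$ The system $(X,T)$ is called - $\mu$-mean equicontinuous if for every $\tau>0$ there is a compact set $M\subset X$ with $\mu(M)\ge 1-\tau$ such that for every $\varepsilon>0$ there is $\delta>0$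 such that $d_b(x,y)\le\varepsilon$ whenever $x,y\in M$ and $d_X(x,y)\le\delta$; - $\mu$-$f$-mean equicontinuous if the same holds with $\rho_f$ in place of $d_b$; - $\mu$-mean sensitive if there is $\varepsilon>0$ such that every Borel set $A$ with $\mu(A)>0$ contains points $x,y$ with $d_b(x,y)>\varepsilon$. The system $(X,\mu,T)$ has discrete spectrum if $L^2(X,\mu)$ has an orthonormal basis consisting of eigenfunctions, where an eigenfunction is a nonzero $f\in L^2(X,\mu)$ for which there is $w\in\mathbb R^d$ with $f\circ T^j=e^{2\pi i\langle w,j\rangle}f$ in $L^2(X,\mu)$ for all $j\in\mathbb G$. Then the following conditions are equivalent: 1. $(X,T)$ is $\mu$-mean equicontinuous; 2. $(X,T)$ is $\mu$-$1_B$-mean equicontinuous for every Borel set $B\subset X$; 3. $(X,T)$ is $\mu$-$f$-mean equicontinuous for every $f\in L^2(X,\mu)$; 4. $(X,\mu,T)$ has discrete spectrum; 5. $(X,T)$ is not $\mu$-mean sensitive. -/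

import Mathlib

open MeasureTheory Filter Topology
open scoped ENNReal

noncomputable section

namespace MeanEquicontinuity

/-! The acting group is `Fin d → R` with `R = ℤ` (equipped with the counting measure) or `R = ℝ`
(equipped with Lebesgue measure). The reference measure on the group is written `ν`, and the
element `T^j x` is written `j +ᵥ x`. -/

/-- The cube `F_n = [0, n]^d` in the group `R^d`. -/
def cube (R : Type) [Zero R] [NatCast R] [Preorder R] (d n : ℕ) : Set (Fin d → R) :=
  Set.Icc 0 (fun _ => (n : R))

variable {R : Type} [Zero R] [NatCast R] [Preorder R] [MeasurableSpace R] {d : ℕ}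
variable {X : Type*}

/-- The upper density `limsup ν(S ∩ F_n) / ν(F_n)` of a subset `S` of the group. -/
def upperDensity (ν : Measure (Fin d → R)) (S : Set (Fin d → R)) : ℝ≥0∞ :=
  limsup (fun n : ℕ => ν (S ∩ cube R d n) / ν (cube R d n)) atTop

/-- The Besicovitch pseudometric
`d_b(x, y) = limsup ν(F_n)⁻¹ ∫_{j ∈ F_n} d(T^j x, T^j y) dν(j)`. -/
def dB [PseudoEMetricSpace X] [VAdd (Fin d → R) X] (ν : Measure (Fin d → R)) (x y : X) : ℝ≥0∞ :=
  limsup (fun n : ℕ =>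
    (∫⁻ j in cube R d n, edist (j +ᵥ x) (j +ᵥ y) ∂ν) / ν (cube R d n)) atTop

/-- The pseudometric
`ρ_f(x, y) = inf {ε > 0 : upperDensity {j : |f(T^j x) - f(T^j y)| > ε} < ε}`. -/
def rho [VAdd (Fin d → R) X] (ν : Measure (Fin d → R)) (f : X → ℂ) (x y : X) : ℝ :=
  sInf {ε : ℝ | 0 < ε ∧
    upperDensity ν {j | ε < ‖f (j +ᵥ x) - f (j +ᵥ y)‖} < ENNReal.ofReal ε}

/-- `μ`-mean equicontinuity of the action of `R^d` on the metric space `X`. -/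
def MuMeanEquicontinuous [MetricSpace X] [MeasurableSpace X] [VAdd (Fin d → R) X]
    (ν : Measure (Fin d → R)) (μ : Measure X) : Prop :=
  ∀ τ : ℝ, 0 < τ → ∃ M : Set X, IsCompact M ∧ 1 - τ ≤ μ.real M ∧
    ∀ ε : ℝ, 0 < ε → ∃ δ : ℝ, 0 < δ ∧
      ∀ x ∈ M, ∀ y ∈ M, dist x y ≤ δ → dB ν x y ≤ ENNReal.ofReal ε

/-- `μ`-`f`-mean equicontinuity of the action of `R^d` on the metric space `X`. -/
def MuFunMeanEquicontinuous [MetricSpace X] [MeasurableSpace X] [VAdd (Fin d → R) X]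
    (ν : Measure (Fin d → R)) (μ : Measure X) (f : X → ℂ) : Prop :=
  ∀ τ : ℝ, 0 < τ → ∃ M : Set X, IsCompact M ∧ 1 - τ ≤ μ.real M ∧
    ∀ ε : ℝ, 0 < ε → ∃ δ : ℝ, 0 < δ ∧
      ∀ x ∈ M, ∀ y ∈ M, dist x y ≤ δ → rho ν f x y ≤ ε

/-- `μ`-mean sensitivity of the action of `R^d` on the metric space `X`. -/
def MuMeanSensitive [MetricSpace X] [MeasurableSpace X] [VAdd (Fin d → R) X]
    (ν : Measure (Fin d → R)) (μ : Measure X) : Prop :=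
  ∃ ε : ℝ, 0 < ε ∧ ∀ A : Set X, MeasurableSet A → 0 < μ A →
    ∃ x ∈ A, ∃ y ∈ A, ENNReal.ofReal ε < dB ν x y

/-- Ergodicity of a probability measure: it is invariant, and every measurable set that is
invariant under the whole group `G` has measure `0` or `1`. -/
def IsErgodicMeasure (G : Type*) [VAdd G X] [MeasurableSpace X] (μ : Measure X) : Prop :=
  VAddInvariantMeasure G X μ ∧
    ∀ A : Set X, MeasurableSet A → (∀ g : G, (fun x => g +ᵥ x) ⁻¹' A = A) → μ A = 0 ∨ μ A = 1

/-- An eigenfunction of the action: a nonzero `f ∈ L²(X, μ)` such that for some `w ∈ ℝ^d` one has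
`f ∘ T^j = exp(2πi⟨w, j⟩) f` in `L²(X, μ)` for every `j` in the group. -/
def IsEigenfunction (R : Type) [SMul R ℝ] (d : ℕ) {X : Type*} [VAdd (Fin d → R) X]
    [MeasurableSpace X] (μ : Measure X) (f : Lp ℂ 2 μ) : Prop :=
  f ≠ 0 ∧ ∃ w : Fin d → ℝ, ∀ j : Fin d → R,
    (fun x => f (j +ᵥ x)) =ᵐ[μ]
      fun x => Complex.exp (2 * Real.pi * Complex.I * ((∑ i, j i • w i : ℝ) : ℂ)) * f x

/-- Discrete spectrum: `L²(X, μ)` has an orthonormal basis consisting of eigenfunctions. -/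
def HasDiscreteSpectrum (R : Type) [SMul R ℝ] (d : ℕ) {X : Type*} [VAdd (Fin d → R) X]
    [MeasurableSpace X] (μ : Measure X) : Prop :=
  ∃ (s : Set (Lp ℂ 2 μ)) (b : HilbertBasis s ℂ (Lp ℂ 2 μ)),
    (∀ f : s, b f = f) ∧ ∀ f ∈ s, IsEigenfunction R d μ f

end MeanEquicontinuity

end

/-!
Everything but the last step takes place for an action of an abelian group `G` on `X` together with
an *averaging sequence* of subsets of `G` (`IsAveragingSequence`); the cubes `[0, n]^d` are such
sequences, both in the lattice and in the vector space. With the conditions numbered as in the list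
of the theorem, the cycle `4 → 3 → 2 → 1 → 5 → 4` gives `IsAveragingSequence.tfae`.

* `4 → 3`. An eigenfunction is uniformly continuous, up to a small error, on a compact set of measure
  close to one, and along orbits it only changes by phases, so nearby points of that set have orbits
  along which its values stay close. The same follows for a linear combination `h` of
  eigenfunctions (`isOrbitEquicontinuous_of_mem_span`). A square integrable `f` is close in `L²` to
  such an `h`, hence close off a set `B` of small measure. No pointwise ergodic theorem is needed to
  see that most orbits spend little time in `B`: the Vitali covering lemma in `G` yields a maximal
  inequality (`IsAveragingSequence.mul_measure_maximal_le`), and together with ergodicity the upper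
  density of the return times to `B` is at most a constant times `μ B`.
* `3 → 2` is clear. For `2 → 1`, cover `X` by finitely many small balls: at the times at which two
  orbits visit the same balls, they are close.
* `1 → 5`. A compact set of large measure contains a small piece of positive measure.
* `5 → 4`. The averages along the sequence have a limit along an ultrafilter, which is an invariant
  mean `m` on the bounded continuous functions on `G`. Let `V` be a closed invariant subspace of `L²`
  without joint eigenvectors of the Koopman representation `U`. For `g ∈ V` the mean of the rank one
  operators `h ↦ ⟪U j g, h⟫ U j g` is a positive operator of finite trace, so it is compact
  (`isCompactOperator_of_sum_inner_le`). It commutes with `U`, so a nonzero eigenvalue would produce a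
  joint eigenvector in `V` (`exists_common_eigenvector`). Hence it vanishes, that is,
  `m |⟪h, U j g⟫|² = 0` for all `h` (`IsUnitaryRep.mean_matrixCoeff_mul_star_eq_zero`).
  Now let `f` be continuous, with orthogonal projection `g` to `V`, and let `A` be a set of positive
  measure. By the weak mean ergodic theorem (`mean_matrixCoeff_koopman`), the mean over `j` of
  `∫∫_{A × A} |f (T^j x) - f (T^j y)|²` is
  `2 μ(A)² ‖f‖² - 2 m |⟪1_A, U j f⟫|²`, and the subtracted mean does not see `g`: it is at most
  `m |⟪1_A, U j (f - g)⟫|² ≤ μ(A)² ‖f - g‖²` (`meanSq_indL2_le`), so that the whole is at least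
  `2 μ(A)² ‖g‖²`. If the system is not mean sensitive, there are sets `A` on which it is at
  most `κ μ(A)²` with `κ` as small as desired. So `g = 0` for all `f`, hence `V = 0`
  (`IsAveragingSequence.eq_bot_of_forall_not_eigenvector`). The orthogonal complement of a maximal
  orthonormal set of joint eigenvectors is such a `V`.

A joint eigenvector belongs to a continuous unitary character of `G`. The last step identifies
the characters of `ℤ^d` and `ℝ^d` with the exponentials `j ↦ exp (2πi⟨w, j⟩)`
(`exists_eq_expChar`).
-/

open scoped InnerProductSpace BoundedContinuousFunction

namespace MeanEquicontinuity

set_option linter.unusedSectionVars false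

/-! ### Compact operators and common eigenvectors -/

section Operators

variable {H : Type*} [NormedAddCommGroup H] [InnerProductSpace ℂ H] [CompleteSpace H]

/-- A positive operator of finite trace is compact. -/
theorem isCompactOperator_of_sum_inner_le {S : H →L[ℂ] H} (hS : S.IsPositive) (C : ℝ)
    (hC : ∀ s : Finset H, Orthonormal ℂ (fun v : s => (v : H)) →
      ∑ v ∈ s, (⟪S v, v⟫_ℂ).re ≤ C) : IsCompactOperator S := by
  classical
  -- With `R = √S`, one has `‖R v‖² = ⟪S v, v⟫`; a finite orthonormal family that nearly exhausts
  -- the trace makes `R` small on the orthogonal complement of its span.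
  obtain ⟨R, hR0, hRR⟩ : ∃ R : H →L[ℂ] H, R.IsPositive ∧ R * R = S := by
    have h0 : 0 ≤ S := (ContinuousLinearMap.nonneg_iff_isPositive S).2 hS
    exact ⟨CFC.sqrt S, (ContinuousLinearMap.nonneg_iff_isPositive _).1 (CFC.sqrt_nonneg S),
      CFC.sqrt_mul_sqrt_self S h0⟩
  have hR : ∀ v, (⟪S v, v⟫_ℂ).re = ‖R v‖ ^ 2 := by
    intro v
    have h := hR0.isSymmetric (R v) v
    rw [ContinuousLinearMap.coe_coe] at h
    rw [← hRR, mul_apply_eq_comp, h, inner_self_eq_norm_sq_to_K]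
    norm_cast
  set T : Set ℝ := {t | ∃ s : Finset H, Orthonormal ℂ (fun v : s => (v : H)) ∧
    ∑ v ∈ s, (⟪S v, v⟫_ℂ).re = t} with hT
  have hTb : BddAbove T := ⟨C, by rintro _ ⟨s, hs, rfl⟩; exact hC s hs⟩
  have hTn : T.Nonempty := ⟨0, ∅, by simp [Orthonormal], by simp⟩
  have hclosed := isClosed_setOfPred_isCompactOperator (𝕜₁ := ℂ) (𝕜₂ := ℂ) (σ₁₂ := RingHom.id ℂ)
    (M₁ := H) (M₂ := H)
  refine hclosed.closure_subset (Metric.mem_closure_iff.2 fun ε hε => ?_)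
  -- with this `η`, the error `‖R‖ * η` made by restricting `S` to the span is less than `ε`
  set η : ℝ := ε / (2 * (‖R‖ + 1)) with hη
  have hηpos : 0 < η := by positivity
  obtain ⟨_, ⟨s, hs, rfl⟩, hlt⟩ := exists_lt_of_lt_csSup hTn
    (show sSup T - η ^ 2 < sSup T by have := pow_pos hηpos 2; linarith)
  set K : Submodule ℂ H := Submodule.span ℂ (s : Set H) with hK
  have hfin : FiniteDimensional ℂ K := FiniteDimensional.span_finset ℂ s
  have hsmall : ∀ v ∈ Kᗮ, ‖v‖ = 1 → ‖R v‖ ≤ η := by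
    intro v hv hv1
    have hvs : ∀ u ∈ s, ⟪u, v⟫_ℂ = 0 := fun u hu =>
      (Submodule.mem_orthogonal K v).1 hv u (Submodule.subset_span hu)
    have hvn : v ∉ s := by
      intro h
      have := hvs v h
      rw [inner_self_eq_zero] at this
      simp [this] at hv1
    have ho : Orthonormal ℂ (fun u : (insert v s : Finset H) => (u : H)) := by
      constructor
      · rintro ⟨u, hu⟩
        rcases Finset.mem_insert.1 hu with rfl | hu
        · exact hv1
        · exact hs.1 ⟨u, hu⟩
      · rintro ⟨u, hu⟩ ⟨w, hw⟩ huw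
        have huw' : u ≠ w := fun h => huw (Subtype.ext h)
        change ⟪u, w⟫_ℂ = 0
        rcases Finset.mem_insert.1 hu with hu' | hu' <;>
          rcases Finset.mem_insert.1 hw with hw' | hw'
        · exact absurd (hu'.trans hw'.symm) huw'
        · rw [hu']
          exact inner_eq_zero_symm.1 (hvs w hw')
        · rw [hw']
          exact hvs u hu'
        · exact hs.2 (i := ⟨u, hu'⟩) (j := ⟨w, hw'⟩) (fun h => huw' (congrArg Subtype.val h))
    have h1 : ∑ u ∈ insert v s, (⟪S u, u⟫_ℂ).re ≤ sSup T := le_csSup hTb ⟨_, ho, rfl⟩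
    rw [Finset.sum_insert hvn, hR v] at h1
    exact le_of_sq_le_sq (by linarith) hηpos.le
  have hsmall' : ∀ v ∈ Kᗮ, ‖R v‖ ≤ η * ‖v‖ := by
    intro v hv
    rcases eq_or_ne v 0 with rfl | h0
    · simp
    have hn : ‖v‖ ≠ 0 := norm_ne_zero_iff.2 h0
    have := hsmall (((‖v‖⁻¹ : ℝ) : ℂ) • v) (Submodule.smul_mem _ _ hv)
      (by rw [norm_smul]; simp [hn])
    rw [map_smul, norm_smul] at this
    simp only [Complex.norm_real, norm_inv, norm_norm] at this
    rwa [inv_mul_le_iff₀ (by positivity), mul_comm] at this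
  refine ⟨S ∘L K.starProjection, ?_, ?_⟩
  · have h1 : IsCompactOperator (K.starProjection) := by
      have hid : IsCompactOperator (id : K → K) := isCompactOperator_id_iff_finiteDimensional.2 hfin
      exact (hid.comp_clm (K.orthogonalProjectionOnto)).clm_comp K.subtypeL
    exact h1.clm_comp S
  · rw [dist_eq_norm]
    refine lt_of_le_of_lt (ContinuousLinearMap.opNorm_le_bound _ (M := ‖R‖ * η) (by positivity)
      fun v => ?_) ?_
    · have hsub : (S - S ∘L K.starProjection) v = R (R (v - K.starProjection v)) := by
        rw [← mul_apply_eq_comp, hRR]; simp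
      rw [hsub]
      have hmem : v - K.starProjection v ∈ Kᗮ := Submodule.sub_starProjection_mem_orthogonal v
      have hle : ‖v - K.starProjection v‖ ≤ ‖v‖ := by
        rw [← Submodule.starProjection_orthogonal_val]
        exact Submodule.norm_starProjection_apply_le _ v
      calc ‖R (R (v - K.starProjection v))‖ ≤ ‖R‖ * ‖R (v - K.starProjection v)‖ := R.le_opNorm _
        _ ≤ ‖R‖ * (η * ‖v - K.starProjection v‖) := by gcongr; exact hsmall' _ hmem
        _ ≤ ‖R‖ * (η * ‖v‖) := by gcongr
        _ = ‖R‖ * η * ‖v‖ := by ring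
    · rw [hη, mul_div_assoc', div_lt_iff₀ (by positivity)]
      nlinarith [norm_nonneg R]

end Operators

/-- A commuting family of endomorphisms has a common eigenvector in every nonzero
finite-dimensional invariant subspace. -/
theorem exists_common_eigenvector {ι V : Type*} [AddCommGroup V] [Module ℂ V]
    (U : ι → Module.End ℂ V) (hU : ∀ i j, Commute (U i) (U j)) (K : Submodule ℂ V)
    [FiniteDimensional ℂ K] (hK : K ≠ ⊥) (hinv : ∀ i, ∀ v ∈ K, U i v ∈ K) :
    ∃ v ∈ K, v ≠ 0 ∧ ∀ i, ∃ c : ℂ, U i v = c • v := by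
  induction hn : Module.finrank ℂ K using Nat.strong_induction_on generalizing K with
  | _ n ih =>
    by_cases hsc : ∀ i, ∃ c : ℂ, ∀ v ∈ K, U i v = c • v
    · obtain ⟨v, hv, hv0⟩ := Submodule.exists_mem_ne_zero_of_ne_bot hK
      exact ⟨v, hv, hv0, fun i => (hsc i).imp fun c hc => hc v hv⟩
    · -- some `U i` is not scalar on `K`; it has a proper eigenspace in `K`, which is invariant
      -- because the family commutes
      push Not at hsc
      obtain ⟨i, hi⟩ := hsc
      have : Nontrivial K := Submodule.nontrivial_iff_ne_bot.2 hK
      obtain ⟨c, hc⟩ := Module.End.exists_eigenvalue ((U i).restrict (hinv i))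
      obtain ⟨⟨w, hwK⟩, hw⟩ := hc.exists_hasEigenvector
      have hwc : U i w = c • w := congrArg Subtype.val hw.apply_eq_smul
      have hw0 : w ≠ 0 := fun h => hw.2 (Subtype.ext h)
      obtain ⟨u, huK, hu⟩ := hi c
      set K' : Submodule ℂ V := K ⊓ Module.End.eigenspace (U i) c with hK'
      have hlt : K' < K := lt_of_le_of_ne inf_le_left fun h => by
        have : u ∈ K' := h ▸ huK
        exact hu (Module.End.mem_eigenspace_iff.1 this.2)
      have hfin : FiniteDimensional ℂ K' := Submodule.finiteDimensional_of_le hlt.le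
      obtain ⟨v, hv, hv0, hvc⟩ := ih _ (hn ▸ Submodule.finrank_lt_finrank_of_lt hlt) K'
        (fun h => hw0 ((Submodule.eq_bot_iff _).1 h w ⟨hwK, Module.End.mem_eigenspace_iff.2 hwc⟩))
        (fun j v hv => ⟨hinv j v hv.1, Module.End.mem_eigenspace_iff.2 (by
          have h1 := congrArg (fun f => f v) (hU i j).eq
          simp only [Module.End.mul_apply] at h1
          rw [h1, Module.End.mem_eigenspace_iff.1 hv.2, map_smul])⟩) rfl
      exact ⟨v, hv.1, hv0, hvc⟩

/-! ### Invariant means and unitary representations -/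

section Means

variable {G : Type*} [AddCommGroup G] [TopologicalSpace G]

variable {H : Type*} [NormedAddCommGroup H] [InnerProductSpace ℂ H]

/-- A strongly continuous unitary representation of `G` on the Hilbert space `H`. -/
structure IsUnitaryRep (U : G → H →ₗᵢ[ℂ] H) : Prop where
  zero : ∀ v, U 0 v = v
  add : ∀ i j v, U (i + j) v = U i (U j v)
  cont : ∀ v, Continuous fun j => U j v

namespace IsUnitaryRep

variable {U : G → H →ₗᵢ[ℂ] H}

theorem inner_map_left (hU : IsUnitaryRep U) (j : G) (v w : H) :
    ⟪U j v, w⟫_ℂ = ⟪v, U (-j) w⟫_ℂ := by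
  rw [← (U (-j)).inner_map_map, ← hU.add, neg_add_cancel, hU.zero]

theorem comm (hU : IsUnitaryRep U) (i j : G) (v : H) : U i (U j v) = U j (U i v) := by
  rw [← hU.add, ← hU.add, add_comm]

/-- The matrix coefficient `j ↦ ⟪k, U j h⟫` as a bounded continuous function on the group. -/
noncomputable def matrixCoeff (hU : IsUnitaryRep U) (k h : H) : G →ᵇ ℂ :=
  BoundedContinuousFunction.ofNormedAddCommGroup (fun j => ⟪k, U j h⟫_ℂ)
    (continuous_const.inner (hU.cont h)) (‖k‖ * ‖h‖)
    fun j => (norm_inner_le_norm _ _).trans_eq (by rw [(U j).norm_map])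

@[simp]
theorem matrixCoeff_apply (hU : IsUnitaryRep U) (k h : H) (j : G) :
    hU.matrixCoeff k h j = ⟪k, U j h⟫_ℂ := rfl

theorem norm_matrixCoeff_le (hU : IsUnitaryRep U) (k h : H) :
    ‖hU.matrixCoeff k h‖ ≤ ‖k‖ * ‖h‖ :=
  BoundedContinuousFunction.norm_ofNormedAddCommGroup_le _ (by positivity) _

end IsUnitaryRep

variable [IsTopologicalAddGroup G]

/-- A linear functional on the bounded continuous functions on `G` is an invariant mean if it is
positive, normalized and invariant under translations. Positivity is stated through real parts,
so that it also yields that real functions have real means. -/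
structure IsInvariantMean (m : (G →ᵇ ℂ) →ₗ[ℂ] ℂ) : Prop where
  re_nonneg : ∀ φ : G →ᵇ ℂ, (∀ j, 0 ≤ (φ j).re) → 0 ≤ (m φ).re
  map_one : m 1 = 1
  translate : ∀ (φ : G →ᵇ ℂ) (g : G),
    m (φ.compContinuous ⟨fun j => j + g, continuous_add_const g⟩) = m φ

namespace IsInvariantMean

variable {m : (G →ᵇ ℂ) →ₗ[ℂ] ℂ}

theorem re_mono (hm : IsInvariantMean m) {φ ψ : G →ᵇ ℂ} (h : ∀ j, (φ j).re ≤ (ψ j).re) :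
    (m φ).re ≤ (m ψ).re := by
  have := hm.re_nonneg (ψ - φ) fun j => by simpa using h j
  simpa using this

theorem im_eq_zero (hm : IsInvariantMean m) {φ : G →ᵇ ℂ} (h : ∀ j, (φ j).im = 0) :
    (m φ).im = 0 := by
  have h1 := hm.re_nonneg (Complex.I • φ) fun j => by simp [h j]
  have h2 := hm.re_nonneg (-(Complex.I • φ)) fun j => by simp [h j]
  simp only [map_neg, map_smul, smul_eq_mul, Complex.neg_re, Complex.mul_re, Complex.I_re,
    Complex.I_im] at h1 h2
  linarith

theorem re_le_of_forall_le (hm : IsInvariantMean m) {φ : G →ᵇ ℂ} {C : ℝ}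
    (h : ∀ j, (φ j).re ≤ C) : (m φ).re ≤ C := by
  have := hm.re_mono (φ := φ) (ψ := (C : ℂ) • 1) fun j => by simpa using h j
  simpa [hm.map_one] using this

theorem norm_le (hm : IsInvariantMean m) (φ : G →ᵇ ℂ) : ‖m φ‖ ≤ ‖φ‖ := by
  rcases eq_or_ne (m φ) 0 with h0 | h0
  · rw [h0, norm_zero]; exact norm_nonneg φ
  -- rotate `φ` so that its mean is a nonnegative real number
  set c : ℂ := (‖m φ‖ : ℂ)⁻¹ * (starRingEnd ℂ) (m φ) with hc
  have hn : (‖m φ‖ : ℂ) ≠ 0 := by simpa using h0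
  have hc1 : ‖c‖ = 1 := by
    simp [hc, h0]
  have hcm : m (c • φ) = ‖m φ‖ := by
    rw [map_smul, smul_eq_mul, hc, mul_assoc, Complex.conj_mul', pow_two, inv_mul_cancel_left₀ hn]
  have h1 : (m (c • φ)).re ≤ ‖φ‖ := hm.re_le_of_forall_le fun j => by
    refine (Complex.re_le_norm _).trans ?_
    rw [BoundedContinuousFunction.coe_smul, norm_smul, hc1, one_mul]
    exact φ.norm_coe_le_norm j
  rwa [hcm, Complex.ofReal_re] at h1

end IsInvariantMean

namespace IsUnitaryRep

variable {U : G → H →ₗᵢ[ℂ] H} [CompleteSpace H] {m : (G →ᵇ ℂ) →ₗ[ℂ] ℂ}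

/-- The mean of the rank one operators `h ↦ ⟪U j g, h⟫ U j g`, defined through its sesquilinear
form. -/
theorem exists_mean_operator (hU : IsUnitaryRep U) (hm : IsInvariantMean m) (g : H) :
    ∃ S : H →L[ℂ] H, ∀ k h, ⟪S k, h⟫_ℂ = m (hU.matrixCoeff k g * star (hU.matrixCoeff h g)) := by
  let B : H →L⋆[ℂ] H →L[ℂ] ℂ := LinearMap.mkContinuous₂
    (LinearMap.mk₂'ₛₗ (starRingEnd ℂ) (RingHom.id ℂ)
      (fun k h => m (hU.matrixCoeff k g * star (hU.matrixCoeff h g)))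
      (fun k k' h => by
        rw [← map_add]; congr 1; ext j; simp [add_mul])
      (fun c k h => by
        rw [← map_smul]; congr 1; ext j
        simp [mul_left_comm, mul_assoc])
      (fun k h h' => by
        rw [← map_add]; congr 1; ext j; simp [mul_add])
      (fun c k h => by
        rw [RingHom.id_apply, ← map_smul]; congr 1; ext j
        simp; ring)) (‖g‖ * ‖g‖)
    (fun k h => by
      refine (hm.norm_le _).trans ((norm_mul_le _ _).trans ?_)
      rw [norm_star]
      refine (mul_le_mul (hU.norm_matrixCoeff_le k g) (hU.norm_matrixCoeff_le h g)
        (norm_nonneg _) (by positivity)).trans_eq (by ring))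
  exact ⟨InnerProductSpace.continuousLinearMapOfBilin B, fun k h =>
    InnerProductSpace.continuousLinearMapOfBilin_apply B k h⟩

/-- **Weak mixing.** If the closed invariant subspace `V` contains no common eigenvector of the
representation, then the correlations of `g ∈ V` vanish in quadratic mean. -/
theorem mean_matrixCoeff_mul_star_eq_zero (hU : IsUnitaryRep U) (hm : IsInvariantMean m)
    (V : Submodule ℂ H) (hVc : IsClosed (V : Set H)) (hV : ∀ j, ∀ v ∈ V, U j v ∈ V)
    (hne : ∀ v ∈ V, v ≠ 0 → ¬ ∀ j, ∃ c : ℂ, U j v = c • v) {g : H} (hg : g ∈ V) (h : H) :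
    m (hU.matrixCoeff h g * star (hU.matrixCoeff h g)) = 0 := by
  obtain ⟨S, hS⟩ := hU.exists_mean_operator hm g
  -- `S` is a compact self-adjoint operator which commutes with the representation and takes values
  -- in `V`, so an eigenspace of `S` for a nonzero eigenvalue would contain a common eigenvector
  suffices h0 : S = 0 by rw [← hS, h0]; simp
  have hmul : ∀ k j, (hU.matrixCoeff k g * star (hU.matrixCoeff k g)) j =
      ((‖⟪k, U j g⟫_ℂ‖ ^ 2 : ℝ) : ℂ) := by
    intro k j
    rw [BoundedContinuousFunction.mul_apply, BoundedContinuousFunction.star_apply,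
      matrixCoeff_apply]
    exact (Complex.mul_conj' _).trans (by norm_cast)
  have hpos : S.IsPositive := by
    rw [ContinuousLinearMap.isPositive_iff_complex]
    intro k
    rw [hS]
    refine ⟨Complex.ext (by simp) ?_, hm.re_nonneg _ fun j => ?_⟩
    · exact (hm.im_eq_zero fun j => by rw [hmul, Complex.ofReal_im]).symm ▸ (by simp)
    · rw [hmul, Complex.ofReal_re]; positivity
  -- Bessel's inequality bounds the trace.
  have hcomp : IsCompactOperator S := by
    refine isCompactOperator_of_sum_inner_le hpos (‖g‖ ^ 2) fun s hs => ?_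
    simp_rw [hS]
    rw [← Complex.re_sum, ← map_sum]
    refine hm.re_le_of_forall_le fun j => ?_
    rw [BoundedContinuousFunction.sum_apply]
    simp_rw [hmul]
    rw [← Complex.ofReal_sum, Complex.ofReal_re]
    have := hs.sum_inner_products_le (U j g) (s := Finset.univ)
    rw [(U j).norm_map] at this
    rwa [← Finset.sum_coe_sort]
  have hsymm : (S : H →ₗ[ℂ] H).IsSymmetric := hpos.isSymmetric
  have hcommS : ∀ i v, S (U i v) = U i (S v) := by
    intro i v
    refine ext_inner_right ℂ fun w => ?_
    rw [hU.inner_map_left, hS, hS, ← hm.translate (_ * star (hU.matrixCoeff w g)) i]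
    congr 1
    ext j
    have e1 : ⟪U i v, U (j + i) g⟫_ℂ = ⟪v, U j g⟫_ℂ := by
      rw [hU.inner_map_left, ← hU.add]; congr 3; abel
    have e2 : ⟪U (j + i) g, w⟫_ℂ = ⟪U j g, U (-i) w⟫_ℂ := by
      rw [add_comm, hU.add, hU.inner_map_left]
    simp [e1, e2]
  have hrange : ∀ v, S v ∈ V := by
    intro v
    have : CompleteSpace V := hVc.completeSpace_coe
    rw [← Submodule.orthogonal_orthogonal V, Submodule.mem_orthogonal]
    intro u hu
    rw [← inner_conj_symm, hS]
    have : hU.matrixCoeff u g = 0 := by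
      ext j
      exact (Submodule.mem_orthogonal' V u).1 hu _ (hV j g hg)
    rw [this]; simp
  rw [← ContinuousLinearMap.eq_zero_of_forall_hasEigenvalue_eq_zero hcomp hsymm]
  intro c hc
  by_contra hc0
  have hfin := ContinuousLinearMap.finite_dimensional_eigenspace hcomp c hc0
  obtain ⟨v, hv, hv0, hvc⟩ := exists_common_eigenvector
    (fun j => ((U j).toLinearMap : Module.End ℂ H))
    (fun i j => LinearMap.ext fun v => hU.comm i j v) _ (Module.End.hasEigenvalue_iff.1 hc)
    (fun j v hv => by
      rw [Module.End.mem_eigenspace_iff] at hv ⊢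
      have hv' : S v = c • v := hv
      change S (U j v) = c • U j v
      rw [hcommS, hv', map_smul])
  have hvS : S v = c • v := Module.End.mem_eigenspace_iff.1 hv
  have hvV : v ∈ V := by
    have := V.smul_mem c⁻¹ (hrange v)
    rwa [hvS, smul_smul, inv_mul_cancel₀ hc0, one_smul] at this
  exact hne v hvV hv0 hvc

end IsUnitaryRep

end Means

/-! ### Averaging sequences -/

section Averages

variable {G : Type*} [NormedAddCommGroup G] [MeasurableSpace G] {ν : Measure G} {F : ℕ → Set G}

/-- An averaging sequence: measurable sets `F n` that are asymptotically invariant under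
translations and whose size is comparable to that of the balls of radii `n` and `5 * n`. -/
structure IsAveragingSequence (ν : Measure G) (F : ℕ → Set G) : Prop where
  measurableSet : ∀ n, MeasurableSet (F n)
  subset_closedBall : ∀ n : ℕ, F n ⊆ Metric.closedBall 0 n
  measure_ne_zero : ∀ n, n ≠ 0 → ν (F n) ≠ 0
  tendsto_diff : ∀ g : G,
    Tendsto (fun n => ν (F n \ (fun j => j + g) ⁻¹' F n) / ν (F n)) atTop (𝓝 0)
  doubling : ∃ C : ℝ≥0∞, C ≠ ∞ ∧ ∀ n : ℕ, ν (Metric.closedBall 0 (5 * n)) ≤ C * ν (F n)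

namespace IsAveragingSequence

theorem measure_ne_top [ProperSpace G] [IsFiniteMeasureOnCompacts ν]
    (hF : IsAveragingSequence ν F) (n : ℕ) : ν (F n) ≠ ∞ :=
  ((measure_mono (hF.subset_closedBall n)).trans_lt
    (isCompact_closedBall (0 : G) (n : ℝ)).measure_lt_top).ne

variable [BorelSpace G] [ν.IsAddHaarMeasure]

/-- Asymptotic invariance on the other side: since `F n` and its translates have the same
measure, the two halves of the symmetric difference do as well. -/
theorem tendsto_diff' (hF : IsAveragingSequence ν F) (g : G) :
    Tendsto (fun n => ν (((fun j => j + g) ⁻¹' F n) \ F n) / ν (F n)) atTop (𝓝 0) := by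
  refine (hF.tendsto_diff (-g)).congr fun n => ?_
  rw [← measure_preimage_add_right ν g (F n \ _), Set.preimage_sdiff, ← Set.preimage_comp]
  congr 3
  ext j
  simp

variable [ProperSpace G]

/-- Averages of a bounded function over `F n` and over a translate of `F n` are asymptotically
equal. -/
theorem tendsto_setAverage_translate_sub (hF : IsAveragingSequence ν F) (φ : G →ᵇ ℂ) (g : G) :
    Tendsto (fun n => (⨍ j in F n, φ (j + g) ∂ν) - ⨍ j in F n, φ j ∂ν) atTop (𝓝 0) := by
  have hint : ∀ s : Set G, ν s ≠ ∞ → IntegrableOn φ s ν := fun s hs =>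
    Measure.integrableOn_of_bounded (M := ‖φ‖) hs φ.continuous.aestronglyMeasurable
      (ae_of_all _ fun j => φ.norm_coe_le_norm j)
  set T : ℕ → Set G := fun n => (fun j => j + -g) ⁻¹' F n with hT
  have hTm : ∀ n, MeasurableSet (T n) := fun n => (measurable_add_const (-g)) (hF.measurableSet n)
  have hTfin : ∀ n, ν (T n) ≠ ∞ := fun n => by
    rw [hT, measure_preimage_add_right]; exact hF.measure_ne_top n
  have hshift : ∀ n, ∫ j in F n, φ (j + g) ∂ν = ∫ j in T n, φ j ∂ν := by
    intro n
    have h := (measurePreserving_add_right ν g).setIntegral_preimage_emb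
      (MeasurableEquiv.addRight g).measurableEmbedding φ (T n)
    rw [← h]
    congr 2
    ext j
    simp [hT]
  have key : ∀ n, ‖(⨍ j in F n, φ (j + g) ∂ν) - ⨍ j in F n, φ j ∂ν‖ ≤
      ‖φ‖ * (ν (F n \ T n) / ν (F n) + ν (T n \ F n) / ν (F n)).toReal := by
    intro n
    have e1 := integral_inter_add_sdiff (hTm n) (hint (F n) (hF.measure_ne_top n))
    have e2 := integral_inter_add_sdiff (hF.measurableSet n) (hint (T n) (hTfin n))
    rw [Set.inter_comm] at e2
    have hd1 : ν (F n \ T n) ≠ ∞ := measure_ne_top_of_subset Set.sdiff_subset (hF.measure_ne_top n)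
    have hd2 : ν (T n \ F n) ≠ ∞ := measure_ne_top_of_subset Set.sdiff_subset (hTfin n)
    have b1 : ‖∫ j in F n \ T n, φ j ∂ν‖ ≤ ‖φ‖ * ν.real (F n \ T n) :=
      norm_setIntegral_le_of_norm_le_const hd1.lt_top fun j _ => φ.norm_coe_le_norm j
    have b2 : ‖∫ j in T n \ F n, φ j ∂ν‖ ≤ ‖φ‖ * ν.real (T n \ F n) :=
      norm_setIntegral_le_of_norm_le_const hd2.lt_top fun j _ => φ.norm_coe_le_norm j
    rw [setAverage_eq, setAverage_eq, ← smul_sub, hshift, ← e1, ← e2, add_sub_add_left_eq_sub,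
      norm_smul, ← ENNReal.add_div, ENNReal.toReal_div, ENNReal.toReal_add hd1 hd2]
    simp only [norm_inv, Real.norm_eq_abs, abs_of_nonneg measureReal_nonneg]
    rw [div_eq_inv_mul, mul_left_comm]
    refine mul_le_mul_of_nonneg_left ?_ (inv_nonneg.2 measureReal_nonneg)
    refine (norm_sub_le _ _).trans ?_
    simp only [measureReal_def] at b1 b2
    linarith
  refine squeeze_zero_norm key ?_
  have h1 := (hF.tendsto_diff (-g)).add (hF.tendsto_diff' (-g))
  rw [add_zero] at h1
  have h2 := (ENNReal.tendsto_toReal ENNReal.zero_ne_top).comp h1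
  simpa using h2.const_mul ‖φ‖

/-- Along an averaging sequence there is an invariant mean which is the limit of averages along
an ultrafilter. -/
theorem exists_isInvariantMean (hF : IsAveragingSequence ν F) :
    ∃ (m : (G →ᵇ ℂ) →ₗ[ℂ] ℂ) (𝒰 : Ultrafilter ℕ), IsInvariantMean m ∧ (𝒰 : Filter ℕ) ≤ atTop ∧
      ∀ φ : G →ᵇ ℂ, Tendsto (fun n => ⨍ j in F n, φ j ∂ν) 𝒰 (𝓝 (m φ)) := by
  let 𝒰 : Ultrafilter ℕ := Ultrafilter.of atTop
  have h𝒰 : (𝒰 : Filter ℕ) ≤ atTop := Ultrafilter.of_le _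
  have hint : ∀ (φ : G →ᵇ ℂ) n, IntegrableOn φ (F n) ν := fun φ n =>
    Measure.integrableOn_of_bounded (M := ‖φ‖) (hF.measure_ne_top n)
      φ.continuous.aestronglyMeasurable (ae_of_all _ fun j => φ.norm_coe_le_norm j)
  have hlim : ∀ φ : G →ᵇ ℂ, ∃ c, Tendsto (fun n => ⨍ j in F n, φ j ∂ν) 𝒰 (𝓝 c) := by
    intro φ
    have hb : ∀ n, (⨍ j in F n, φ j ∂ν) ∈ Metric.closedBall (0 : ℂ) ‖φ‖ := by
      intro n
      rw [mem_closedBall_zero_iff, setAverage_eq, norm_smul, norm_inv, Real.norm_eq_abs,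
        abs_of_nonneg measureReal_nonneg]
      have b1 : ‖∫ j in F n, φ j ∂ν‖ ≤ ‖φ‖ * ν.real (F n) :=
        norm_setIntegral_le_of_norm_le_const (hF.measure_ne_top n).lt_top
          fun j _ => φ.norm_coe_le_norm j
      rw [← div_eq_inv_mul]
      exact div_le_of_le_mul₀ measureReal_nonneg (norm_nonneg _) b1
    obtain ⟨c, -, hc⟩ := (isCompact_closedBall (0 : ℂ) ‖φ‖).ultrafilter_le_nhds
      (𝒰.map fun n => ⨍ j in F n, φ j ∂ν)
      (by rw [le_principal_iff]; exact Filter.mem_map.2 (Filter.Eventually.of_forall hb))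
    exact ⟨c, hc⟩
  choose m hm using hlim
  have hpos : ∀ᶠ n in (𝒰 : Filter ℕ), ν (F n) ≠ 0 :=
    h𝒰 ((eventually_ne_atTop 0).mono fun n hn => hF.measure_ne_zero n hn)
  refine ⟨{ toFun := m, map_add' := fun φ ψ => ?_, map_smul' := fun c φ => ?_ }, 𝒰,
    ⟨fun φ hφ => ?_, ?_, fun φ g => ?_⟩, h𝒰, hm⟩
  · refine tendsto_nhds_unique (hm (φ + ψ)) (((hm φ).add (hm ψ)).congr fun n => ?_)
    simp only [setAverage_eq, BoundedContinuousFunction.add_apply]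
    rw [integral_add (hint φ n) (hint ψ n), smul_add]
  · refine tendsto_nhds_unique (hm (c • φ)) (((hm φ).const_smul c).congr fun n => ?_)
    simp only [setAverage_eq, BoundedContinuousFunction.smul_apply]
    rw [integral_smul, smul_comm]
  · refine ge_of_tendsto ((Complex.continuous_re.tendsto _).comp (hm φ)) (.of_forall fun n => ?_)
    simp only [Function.comp, setAverage_eq, Complex.smul_re, smul_eq_mul]
    refine mul_nonneg (inv_nonneg.2 measureReal_nonneg) ?_
    have : (∫ j in F n, φ j ∂ν).re = ∫ j in F n, (φ j).re ∂ν :=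
      (integral_re (𝕜 := ℂ) (hint φ n)).symm
    rw [this]
    exact integral_nonneg fun j => hφ j
  · refine tendsto_nhds_unique (hm 1) (tendsto_const_nhds.congr' ?_)
    filter_upwards [hpos] with n hn
    simp only [BoundedContinuousFunction.coe_one, Pi.one_apply]
    exact (setAverage_const hn (hF.measure_ne_top n) _).symm
  · have h1 := (hF.tendsto_setAverage_translate_sub φ g).mono_left h𝒰
    have h2 := tendsto_nhds_unique h1
      ((hm (φ.compContinuous ⟨fun j => j + g, continuous_add_const g⟩)).sub (hm φ))
    exact sub_eq_zero.1 h2.symm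

end IsAveragingSequence

end Averages


/-! ### Upper density -/

section Density

theorem ennreal_limsup_add_le (u v : ℕ → ℝ≥0∞) :
    limsup (fun n => u n + v n) atTop ≤ limsup u atTop + limsup v atTop := by
  refine ENNReal.le_of_forall_pos_le_add fun ε hε hfin => ?_
  have hu : limsup u atTop ≠ ∞ := (ENNReal.add_lt_top.1 hfin).1.ne
  have hv : limsup v atTop ≠ ∞ := (ENNReal.add_lt_top.1 hfin).2.ne
  have hε2 : (ε : ℝ≥0∞) / 2 ≠ 0 := by simpa using hε.ne'
  have h1 := eventually_lt_of_limsup_lt (ENNReal.lt_add_right hu hε2)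
  have h2 := eventually_lt_of_limsup_lt (ENNReal.lt_add_right hv hε2)
  refine limsup_le_of_le (by isBoundedDefault) ?_
  filter_upwards [h1, h2] with n h1 h2
  refine (add_le_add h1.le h2.le).trans_eq ?_
  rw [add_add_add_comm, ENNReal.add_halves]

variable {G : Type*} [NormedAddCommGroup G] [MeasurableSpace G] {ν : Measure G} {F : ℕ → Set G}

/-- The upper density of a set along a sequence of sets `F`. -/
noncomputable def densityAlong (ν : Measure G) (F : ℕ → Set G) (S : Set G) : ℝ≥0∞ :=
  limsup (fun n => ν (S ∩ F n) / ν (F n)) atTop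

theorem densityAlong_le_one (S : Set G) : densityAlong ν F S ≤ 1 :=
  limsup_le_of_le (by isBoundedDefault) (.of_forall fun _ =>
    ENNReal.div_le_of_le_mul (by rw [one_mul]; exact measure_mono Set.inter_subset_right))

theorem densityAlong_mono_ae {S T : Set G} (h : S ≤ᵐ[ν] T) :
    densityAlong ν F S ≤ densityAlong ν F T :=
  limsup_le_limsup (.of_forall fun n => ENNReal.div_le_div_right
    (measure_mono_ae (h.inter (EventuallyLE.refl _ (F n)))) _)

theorem densityAlong_mono {S T : Set G} (h : S ⊆ T) :
    densityAlong ν F S ≤ densityAlong ν F T :=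
  densityAlong_mono_ae (LE.le.eventuallyLE h)

theorem densityAlong_union_le (S T : Set G) :
    densityAlong ν F (S ∪ T) ≤ densityAlong ν F S + densityAlong ν F T := by
  refine le_trans (limsup_le_limsup (.of_forall fun n => ?_)) (ennreal_limsup_add_le _ _)
  rw [← ENNReal.add_div]
  dsimp only
  rw [Set.union_inter_distrib_right]
  exact ENNReal.div_le_div_right (measure_union_le _ _) _

variable [BorelSpace G] [ν.IsAddHaarMeasure]

theorem IsAveragingSequence.densityAlong_translate_le (hF : IsAveragingSequence ν F) (S : Set G)
    (g : G) : densityAlong ν F ((fun j => j + g) ⁻¹' S) ≤ densityAlong ν F S := by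
  have h0 := (hF.tendsto_diff' (-g)).limsup_eq
  have hle : ∀ n, ν ((fun j => j + g) ⁻¹' S ∩ F n) / ν (F n) ≤
      ν (S ∩ F n) / ν (F n) + ν (((fun j => j + -g) ⁻¹' F n) \ F n) / ν (F n) := by
    intro n
    rw [← ENNReal.add_div]
    refine ENNReal.div_le_div_right ?_ _
    have h1 : (fun j => j + g) ⁻¹' S ∩ F n =
        (fun j => j + g) ⁻¹' (S ∩ ((fun j => j + -g) ⁻¹' F n)) := by
      ext j; simp
    rw [h1, measure_preimage_add_right]
    refine (measure_mono fun j hj => ?_).trans (measure_union_le _ _)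
    by_cases hjF : j ∈ F n
    · exact Or.inl ⟨hj.1, hjF⟩
    · exact Or.inr ⟨hj.2, hjF⟩
  refine (limsup_le_limsup (.of_forall hle)).trans ((ennreal_limsup_add_le _ _).trans_eq ?_)
  rw [h0, add_zero]; rfl

theorem IsAveragingSequence.densityAlong_translate (hF : IsAveragingSequence ν F) (S : Set G)
    (g : G) : densityAlong ν F ((fun j => j + g) ⁻¹' S) = densityAlong ν F S := by
  refine le_antisymm (hF.densityAlong_translate_le S g) ?_
  refine le_trans (le_of_eq ?_) (hF.densityAlong_translate_le _ (-g))
  rw [← Set.preimage_comp]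
  congr 1
  ext j
  simp

end Density

/-! ### Ergodic measures and the maximal inequality -/

section Ergodic

variable {G : Type*} [NormedAddCommGroup G] [ProperSpace G] [MeasurableSpace G] [BorelSpace G]
  {ν : Measure G} [ν.IsAddHaarMeasure] {F : ℕ → Set G}
  {X : Type*} [MetricSpace X] [CompactSpace X] [MeasurableSpace X] [BorelSpace X]
  [AddAction G X] [ContinuousVAdd G X] {μ : Measure X} [IsProbabilityMeasure μ]

/-- The set of return times of `x` to `E`. -/
def returnTimes (G : Type*) {X : Type*} [VAdd G X] (E : Set X) (x : X) : Set G := {j | j +ᵥ x ∈ E}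

theorem measurable_vadd_swap : Measurable fun p : X × G => p.2 +ᵥ p.1 :=
  (continuous_snd.vadd continuous_fst).measurable

theorem measurableSet_returnTimes {E : Set X} (hE : MeasurableSet E) (x : X) :
    MeasurableSet (returnTimes G E x) :=
  (continuous_id.vadd (continuous_const (y := x))).measurable hE

theorem returnTimes_vadd (E : Set X) (x : X) (g : G) :
    returnTimes G E (g +ᵥ x) = (fun j => j + g) ⁻¹' returnTimes G E x := by
  ext j; simp [returnTimes, add_vadd]

theorem measurable_measure_returnTimes_inter {E : Set X} (hE : MeasurableSet E) {K : Set G}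
    (hK : MeasurableSet K) : Measurable fun x => ν (returnTimes G E x ∩ K) :=
  measurable_measure_prodMk_left (ν := ν)
    ((measurable_vadd_swap hE).inter (measurable_snd hK) : MeasurableSet
      {p : X × G | p.2 +ᵥ p.1 ∈ E ∧ p.2 ∈ K})

theorem lintegral_measure_returnTimes_inter (hμ : VAddInvariantMeasure G X μ) {E : Set X}
    (hE : MeasurableSet E) (K : Set G) :
    ∫⁻ x, ν (returnTimes G E x ∩ K) ∂μ = ν K * μ E := by
  have h1 : ∀ x, ν (returnTimes G E x ∩ K) =
      ∫⁻ j in K, E.indicator (fun _ => (1 : ℝ≥0∞)) (j +ᵥ x) ∂ν := by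
    intro x
    have : (fun j : G => E.indicator (fun _ => (1 : ℝ≥0∞)) (j +ᵥ x)) =
        (returnTimes G E x).indicator (fun _ => (1 : ℝ≥0∞)) := by
      ext j; rfl
    rw [this, lintegral_indicator (measurableSet_returnTimes hE x), setLIntegral_const, one_mul,
      Measure.restrict_apply (measurableSet_returnTimes hE x)]
  simp_rw [h1]
  rw [lintegral_lintegral_swap]
  · have h2 : ∀ j : G, ∫⁻ x, E.indicator (fun _ => (1 : ℝ≥0∞)) (j +ᵥ x) ∂μ = μ E := by
      intro j
      have hj := (measurePreserving_vadd j μ).lintegral_comp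
        ((measurable_const (a := (1 : ℝ≥0∞))).indicator hE)
      rw [hj, lintegral_indicator hE, setLIntegral_const, one_mul]
    simp_rw [h2]
    rw [setLIntegral_const, mul_comm]
  · exact (((measurable_const (a := (1 : ℝ≥0∞))).indicator hE).comp
      measurable_vadd_swap).aemeasurable

/-- A property that holds almost everywhere holds, for almost every `x`, at almost every point
of the orbit of `x`. -/
theorem ae_ae_vadd (hμ : VAddInvariantMeasure G X μ) {P : X → Prop} (h : ∀ᵐ x ∂μ, P x) :
    ∀ᵐ x ∂μ, ∀ᵐ j : G ∂ν, P (j +ᵥ x) := by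
  obtain ⟨N, hN, hNm, hN0⟩ := exists_measurable_superset_of_null h
  have h1 : ∀ᵐ x ∂μ, ∀ᵐ j : G ∂ν, j +ᵥ x ∉ N := by
    rw [Measure.ae_ae_comm (p := fun x (j : G) => j +ᵥ x ∉ N)
      (measurable_vadd_swap hNm.compl)]
    refine ae_of_all _ fun j => ?_
    have := (measurePreserving_vadd j μ).measure_preimage hNm.nullMeasurableSet
    rw [hN0] at this
    exact measure_eq_zero_iff_ae_notMem.1 this
  filter_upwards [h1] with x hx
  filter_upwards [hx] with j hj
  by_contra hP
  exact hj (hN hP)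

/-- For an ergodic measure, sets that are invariant up to null sets are trivial. Such a set agrees
almost everywhere with the strictly invariant set of all points whose orbit misses its complement
up to a null set of times. -/
theorem measure_eq_zero_or_one_of_ae_invariant (ν : Measure G) [ν.IsAddHaarMeasure]
    (hμ : IsErgodicMeasure G μ) {A : Set X} (hA : MeasurableSet A)
    (hinv : ∀ g : G, ∀ᵐ x ∂μ, g +ᵥ x ∈ A ↔ x ∈ A) : μ A = 0 ∨ μ A = 1 := by
  set A' : Set X := {x | ν (returnTimes G Aᶜ x ∩ Set.univ) = 0} with hA'
  have hA'm : MeasurableSet A' :=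
    measurable_measure_returnTimes_inter hA.compl MeasurableSet.univ (measurableSet_singleton 0)
  have hA'inv : ∀ g : G, (fun x => g +ᵥ x) ⁻¹' A' = A' := by
    intro g
    ext x
    simp only [hA', Set.mem_preimage, Set.mem_ofPred_eq, Set.inter_univ, returnTimes_vadd,
      measure_preimage_add_right]
  have h1 : ∀ᵐ x ∂μ, ∀ᵐ j : G ∂ν, (j +ᵥ x ∈ A ↔ x ∈ A) := by
    rw [Measure.ae_ae_comm (p := fun x (j : G) => j +ᵥ x ∈ A ↔ x ∈ A)]
    · exact ae_of_all _ hinv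
    · exact (measurable_vadd_swap hA).iff (measurable_fst hA)
  have hae : A' =ᵐ[μ] A := by
    filter_upwards [h1] with x hx
    refine propext ⟨fun h => ?_, fun h => ?_⟩
    · have h0 : ∀ᵐ j : G ∂ν, j +ᵥ x ∈ A := by
        have h' : ν (returnTimes G Aᶜ x ∩ Set.univ) = 0 := h
        rw [Set.inter_univ] at h'
        filter_upwards [measure_eq_zero_iff_ae_notMem.1 h'] with j hj
        simpa [returnTimes] using hj
      obtain ⟨j, hj1, hj2⟩ := (hx.and h0).exists
      exact hj1.1 hj2
    · change ν (returnTimes G Aᶜ x ∩ Set.univ) = 0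
      rw [Set.inter_univ, measure_eq_zero_iff_ae_notMem]
      filter_upwards [hx] with j hj
      simpa [returnTimes] using hj.2 h
  rw [← measure_congr hae]
  exact hμ.2 A' hA'm hA'inv

/-- **Maximal inequality.** It is transferred from the Vitali covering lemma in the group: the
orbit of a point is covered by balls on which the return times to `B` have density above `c`. -/
theorem IsAveragingSequence.mul_measure_maximal_le (hF : IsAveragingSequence ν F) {C : ℝ≥0∞}
    (hC : ∀ n : ℕ, ν (Metric.closedBall 0 (5 * n)) ≤ C * ν (F n))
    (hμ : VAddInvariantMeasure G X μ) {B : Set X} (hB : MeasurableSet B) (c : ℝ≥0∞) (N : ℕ)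
    (hN : N ≠ 0) :
    c * μ {x | ∃ n ≤ N, c * ν (F n) < ν (returnTimes G B x ∩ F n)} ≤ C * C * μ B := by
  set E : Set X := {x | ∃ n ≤ N, c * ν (F n) < ν (returnTimes G B x ∩ F n)} with hE
  have hEm : MeasurableSet E := by
    have : E = ⋃ n ∈ Set.Iic N, {x | c * ν (F n) < ν (returnTimes G B x ∩ F n)} := by
      ext x; simp [hE]
    rw [this]
    exact MeasurableSet.biUnion (Set.to_countable _) fun n _ => measurableSet_lt measurable_const
      (measurable_measure_returnTimes_inter hB (hF.measurableSet n))
  have hcb : ∀ (x : G) (r : ℝ), ν (Metric.closedBall x r) = ν (Metric.closedBall 0 r) := by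
    intro x r
    rw [← measure_preimage_add_right ν x (Metric.closedBall x r)]
    congr 1
    ext j
    simp [dist_eq_norm]
  have hpt : ∀ x : X, c * ν (returnTimes G E x ∩ Metric.closedBall 0 N) ≤
      C * ν (returnTimes G B x ∩ Metric.closedBall 0 (2 * N)) := by
    intro x
    set J : Set G := returnTimes G E x ∩ Metric.closedBall 0 N with hJ
    have hJn : ∀ j ∈ J, ∃ n ≤ N, c * ν (F n) <
        ν (returnTimes G B x ∩ Metric.closedBall j (n : ℝ)) := by
      rintro j ⟨⟨n, hn, hlt⟩, -⟩
      refine ⟨n, hn, hlt.trans_le ?_⟩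
      have h1 : returnTimes G B (j +ᵥ x) ∩ F n ⊆
          (fun i => i + j) ⁻¹' (returnTimes G B x ∩ Metric.closedBall j (n : ℝ)) := by
        rw [returnTimes_vadd]
        rintro i ⟨hi1, hi2⟩
        refine ⟨hi1, ?_⟩
        have := hF.subset_closedBall n hi2
        simpa [dist_eq_norm] using this
      exact (measure_mono h1).trans_eq (measure_preimage_add_right ν j _)
    classical
    set r : G → ℕ := fun j => if h : j ∈ J then (hJn j h).choose else 0 with hr
    have hr1 : ∀ j ∈ J, r j ≤ N ∧ c * ν (F (r j)) <
        ν (returnTimes G B x ∩ Metric.closedBall j (r j : ℝ)) := by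
      intro j hj
      simp only [hr, dif_pos hj]
      exact (hJn j hj).choose_spec
    obtain ⟨u, huJ, hud, hcov⟩ := Vitali.exists_disjoint_subfamily_covering_enlargement_closedBall
      J id (fun j => (r j : ℝ)) N (fun j hj => by exact_mod_cast (hr1 j hj).1) 5 (by norm_num)
    set As : u → Set G := fun j => returnTimes G B x ∩ Metric.closedBall (j : G) (r j : ℝ) with hAs
    have hAsm : ∀ j, MeasurableSet (As j) := fun j =>
      (measurableSet_returnTimes hB x).inter Metric.isClosed_closedBall.measurableSet
    have hAsd : Pairwise (Function.onFun Disjoint As) := fun i j hij =>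
      (hud i.2 j.2 (fun h => hij (Subtype.ext h))).mono Set.inter_subset_right
        Set.inter_subset_right
    have hucount : Countable u := by
      have h := Measure.countable_meas_pos_of_disjoint_iUnion (μ := ν) hAsm hAsd
      have huniv : {i : u | 0 < ν (As i)} = Set.univ :=
        Set.eq_univ_of_forall fun j => zero_le.trans_lt (hr1 j (huJ j.2)).2
      rw [huniv] at h
      exact Set.countable_univ_iff.1 h
    have hJcov : J ⊆ ⋃ j : u, Metric.closedBall (j : G) (5 * (r j : ℝ)) := by
      intro j hj
      obtain ⟨b, hb, hsub⟩ := hcov j hj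
      exact Set.mem_iUnion.2 ⟨⟨b, hb⟩, hsub (Metric.mem_closedBall_self (Nat.cast_nonneg _))⟩
    calc c * ν J ≤ c * ∑' j : u, ν (Metric.closedBall (j : G) (5 * (r j : ℝ))) := by
          gcongr
          exact (measure_mono hJcov).trans (measure_iUnion_le _)
      _ ≤ c * ∑' j : u, C * ν (F (r j)) := by
          gcongr with j
          rw [hcb]
          exact hC _
      _ = C * ∑' j : u, c * ν (F (r j)) := by
          rw [ENNReal.tsum_mul_left, ENNReal.tsum_mul_left, mul_left_comm]
      _ ≤ C * ∑' j : u, ν (As j) := by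
          gcongr with j
          exact (hr1 j (huJ j.2)).2.le
      _ = C * ν (⋃ j, As j) := by rw [measure_iUnion hAsd hAsm]
      _ ≤ C * ν (returnTimes G B x ∩ Metric.closedBall 0 (2 * N)) := by
          gcongr
          refine Set.iUnion_subset fun j => Set.inter_subset_inter_right _ ?_
          refine Metric.closedBall_subset_closedBall' ?_
          have h1 : dist (j : G) 0 ≤ N := (huJ j.2).2
          have h2 : (r j : ℝ) ≤ N := by exact_mod_cast (hr1 j (huJ j.2)).1
          linarith
  have hcbm : ∀ R : ℝ, MeasurableSet (Metric.closedBall (0 : G) R) := fun R =>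
    Metric.isClosed_closedBall.measurableSet
  have hint : c * (ν (Metric.closedBall 0 (N : ℝ)) * μ E) ≤
      C * (ν (Metric.closedBall 0 (2 * (N : ℝ))) * μ B) := by
    rw [← lintegral_measure_returnTimes_inter hμ hEm,
      ← lintegral_measure_returnTimes_inter hμ hB,
      ← lintegral_const_mul _ (measurable_measure_returnTimes_inter hEm (hcbm _)),
      ← lintegral_const_mul _ (measurable_measure_returnTimes_inter hB (hcbm _))]
    exact lintegral_mono hpt
  set b := ν (Metric.closedBall (0 : G) (N : ℝ)) with hb
  have hb0 : b ≠ 0 := fun h => hF.measure_ne_zero N hN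
    (measure_mono_null (hF.subset_closedBall N) h)
  have hbt : b ≠ ∞ := (isCompact_closedBall (0 : G) (N : ℝ)).measure_lt_top.ne
  have h2N : ν (Metric.closedBall 0 (2 * (N : ℝ))) ≤ C * b :=
    (measure_mono (Metric.closedBall_subset_closedBall (by
      have := Nat.cast_nonneg (α := ℝ) N; linarith))).trans
      ((hC N).trans (mul_le_mul_right (measure_mono (hF.subset_closedBall N)) C))
  rw [← ENNReal.mul_le_mul_iff_right hb0 hbt]
  calc b * (c * μ E) = c * (b * μ E) := by ring
    _ ≤ C * (C * b * μ B) := hint.trans (by gcongr)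
    _ = b * (C * C * μ B) := by ring

/-- For an ergodic measure, the upper density of the return times to `B` is at most a constant
times `μ B`, almost everywhere. -/
theorem IsAveragingSequence.exists_densityAlong_returnTimes_le (hF : IsAveragingSequence ν F)
    (hμ : IsErgodicMeasure G μ) : ∃ K : ℝ≥0∞, K ≠ ∞ ∧ ∀ B : Set X, MeasurableSet B →
      ∀ᵐ x ∂μ, densityAlong ν F (returnTimes G B x) ≤ K * μ B := by
  obtain ⟨C, hCt, hC⟩ := hF.doubling
  refine ⟨C * C, ENNReal.mul_ne_top hCt hCt, fun B hB => ?_⟩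
  have hmeas : Measurable fun x => densityAlong ν F (returnTimes G B x) :=
    Measurable.limsup fun n =>
      (measurable_measure_returnTimes_inter hB (hF.measurableSet n)).div_const _
  have key : ∀ c : ℝ≥0∞, C * C * μ B < c →
      ∀ᵐ x ∂μ, densityAlong ν F (returnTimes G B x) ≤ c := by
    intro c hc
    set A : Set X := {x | c < densityAlong ν F (returnTimes G B x)} with hA
    have hAm : MeasurableSet A := measurableSet_lt measurable_const hmeas
    have hAinv : ∀ g : G, (fun x => g +ᵥ x) ⁻¹' A = A := by
      intro g
      ext x
      simp only [hA, Set.mem_preimage, Set.mem_ofPred_eq, returnTimes_vadd,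
        hF.densityAlong_translate]
    rcases hμ.2 A hAm hAinv with h | h
    · filter_upwards [measure_eq_zero_iff_ae_notMem.1 h] with x hx
      exact not_lt.1 hx
    exfalso
    set E : ℕ → Set X := fun N => {x | ∃ n ≤ N, c * ν (F n) < ν (returnTimes G B x ∩ F n)} with hE
    have hEmono : Monotone E := fun N M hNM x ⟨n, hn, hx⟩ => ⟨n, hn.trans hNM, hx⟩
    have hAE : A ⊆ ⋃ N, E N := by
      intro x hx
      obtain ⟨n, hn, hn0⟩ := ((frequently_lt_of_lt_limsup
        (u := fun n => ν (returnTimes G B x ∩ F n) / ν (F n))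
        (by isBoundedDefault) hx).and_eventually (eventually_ne_atTop 0)).exists
      refine Set.mem_iUnion.2 ⟨n, n, le_rfl, ?_⟩
      rwa [ENNReal.lt_div_iff_mul_lt (Or.inl (hF.measure_ne_zero n hn0))
        (Or.inl (hF.measure_ne_top n))] at hn
    have h1 : μ (⋃ N, E N) = 1 :=
      le_antisymm prob_le_one (h ▸ measure_mono hAE)
    have hlim := tendsto_measure_iUnion_atTop (μ := μ) hEmono
    rw [h1] at hlim
    have hc0 : C * C * μ B < ∞ := ENNReal.mul_lt_top (ENNReal.mul_lt_top hCt.lt_top hCt.lt_top)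
      (measure_lt_top μ B)
    have hle : c * 1 ≤ C * C * μ B :=
      le_of_tendsto (ENNReal.Tendsto.const_mul hlim (Or.inl one_ne_zero))
        ((eventually_ne_atTop 0).mono fun N hN0 =>
          hF.mul_measure_maximal_le hC hμ.1 hB c N hN0)
    rw [mul_one] at hle
    exact absurd hle (not_le.2 hc)
  have hfin : C * C * μ B ≠ ∞ :=
    ENNReal.mul_ne_top (ENNReal.mul_ne_top hCt hCt) (MeasureTheory.measure_ne_top μ B)
  obtain ⟨c, -, hc, hclim⟩ := exists_seq_strictAnti_tendsto' hfin.lt_top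
  filter_upwards [ae_all_iff.2 fun n => key (c n) (hc n).1] with x hx
  exact ge_of_tendsto' hclim hx

end Ergodic

/-! ### Compact sets of measure close to one -/

section LargeCompacts

variable {X : Type*} [MetricSpace X] [CompactSpace X] [MeasurableSpace X] [BorelSpace X]
  {μ : Measure X} [IsProbabilityMeasure μ]

/-- The property `P` of sets holds for compact sets of measure arbitrarily close to one. -/
def OnLargeCompacts (μ : Measure X) (P : Set X → Prop) : Prop :=
  ∀ τ : ℝ, 0 < τ → ∃ M : Set X, IsCompact M ∧ 1 - τ ≤ μ.real M ∧ P M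

theorem OnLargeCompacts.mono {P Q : Set X → Prop} (h : OnLargeCompacts μ P)
    (hPQ : ∀ M, P M → Q M) : OnLargeCompacts μ Q := fun τ hτ =>
  (h τ hτ).imp fun M hM => ⟨hM.1, hM.2.1, hPQ M hM.2.2⟩

/-- Countably many hereditary properties can be achieved simultaneously: intersect compact sets
whose complements have a total measure less than `τ`. -/
theorem OnLargeCompacts.forall {ι : Type*} [Countable ι] {P : ι → Set X → Prop}
    (hanti : ∀ i M N, M ⊆ N → P i N → P i M) (h : ∀ i, OnLargeCompacts μ (P i)) :
    OnLargeCompacts μ fun M => ∀ i, P i M := by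
  intro τ hτ
  obtain ⟨ε, hε, c, hc, hcτ⟩ := NNReal.exists_pos_sum_of_countable
    (ε := ⟨τ, hτ.le⟩) (fun h => hτ.ne' (congrArg NNReal.toReal h)) ι
  choose M hMc hM hPM using fun i => h i (ε i) (hε i)
  refine ⟨⋂ i, M i, ?_, ?_, fun i => hanti i _ _ (Set.iInter_subset _ i) (hPM i)⟩
  · exact (isClosed_iInter fun i => (hMc i).isClosed).isCompact
  have hmeas : MeasurableSet (⋂ i, M i) := MeasurableSet.iInter fun i => (hMc i).measurableSet
  have h1 : ∀ i, μ (M i)ᶜ ≤ ε i := by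
    intro i
    have h2 : μ.real (M i)ᶜ ≤ ε i := by
      rw [probReal_compl_eq_one_sub (hMc i).measurableSet]; linarith [hM i]
    rw [measureReal_def] at h2
    rw [← ENNReal.ofReal_coe_nnreal]
    exact (ENNReal.le_ofReal_iff_toReal_le (measure_ne_top _ _) (NNReal.coe_nonneg _)).2 h2
  have h3 : μ (⋂ i, M i)ᶜ ≤ (c : ℝ≥0∞) := by
    rw [Set.compl_iInter]
    refine (measure_iUnion_le _).trans ((ENNReal.tsum_le_tsum h1).trans_eq ?_)
    exact (ENNReal.hasSum_coe.2 hc).tsum_eq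
  have h4 : μ.real (⋂ i, M i)ᶜ ≤ c := by
    rw [measureReal_def]
    exact ENNReal.toReal_le_coe_of_le_coe h3
  rw [probReal_compl_eq_one_sub hmeas] at h4
  have h5 : (c : ℝ) < τ := hcτ
  linarith

theorem OnLargeCompacts.and {P Q : Set X → Prop} (hP : OnLargeCompacts μ P)
    (hQ : OnLargeCompacts μ Q) (hPa : ∀ M N, M ⊆ N → P N → P M)
    (hQa : ∀ M N, M ⊆ N → Q N → Q M) : OnLargeCompacts μ fun M => P M ∧ Q M :=
  (OnLargeCompacts.forall (P := fun b : Bool => bif b then P else Q)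
    (by rintro (_ | _); exacts [hQa, hPa]) (by rintro (_ | _); exacts [hQ, hP])).mono
    fun _ hM => ⟨hM true, hM false⟩

theorem exists_isCompact_subset_of_measure_compl_lt {s : Set X} {τ : ℝ}
    (h : μ sᶜ < ENNReal.ofReal τ) : ∃ M ⊆ s, IsCompact M ∧ 1 - τ ≤ μ.real M := by
  set t := (toMeasurable μ sᶜ)ᶜ with ht
  have hts : t ⊆ s := Set.compl_subset_comm.1 (subset_toMeasurable μ sᶜ)
  have htm : MeasurableSet t := (measurableSet_toMeasurable μ sᶜ).compl
  have hμt : 1 - ENNReal.ofReal τ < μ t ∨ 1 - ENNReal.ofReal τ = 0 := by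
    rw [ht, prob_compl_eq_one_sub (measurableSet_toMeasurable μ sᶜ), measure_toMeasurable]
    rcases le_or_gt 1 (ENNReal.ofReal τ) with h1 | h1
    · exact Or.inr (tsub_eq_zero_of_le h1)
    · refine Or.inl (lt_tsub_iff_right.2 ?_)
      calc 1 - ENNReal.ofReal τ + μ sᶜ < 1 - ENNReal.ofReal τ + ENNReal.ofReal τ :=
            ENNReal.add_lt_add_left (by finiteness) h
        _ = 1 := tsub_add_cancel_of_le h1.le
  have conv : ∀ M : Set X, 1 - ENNReal.ofReal τ ≤ μ M → 1 - τ ≤ μ.real M := by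
    intro M hM
    have h2 : (1 : ℝ≥0∞) ≤ μ M + ENNReal.ofReal τ := tsub_le_iff_right.1 hM
    have h3 := ENNReal.toReal_mono (by finiteness) h2
    rw [ENNReal.toReal_add (by finiteness) (by finiteness), ENNReal.toReal_one,
      ENNReal.toReal_ofReal (le_of_lt (ENNReal.ofReal_pos.1 (zero_le.trans_lt h)))] at h3
    rw [measureReal_def]; linarith
  rcases hμt with h1 | h1
  · obtain ⟨M, hMt, hMc, hM⟩ := htm.exists_lt_isCompact h1
    exact ⟨M, hMt.trans hts, hMc, conv M hM.le⟩
  · exact ⟨∅, Set.empty_subset _, isCompact_empty, conv _ (h1 ▸ zero_le)⟩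

theorem onLargeCompacts_of_ae {P : X → Prop} (h : ∀ᵐ x ∂μ, P x) :
    OnLargeCompacts μ fun M => ∀ x ∈ M, P x := by
  intro τ hτ
  obtain ⟨M, hM, hMc, hMτ⟩ := exists_isCompact_subset_of_measure_compl_lt (μ := μ)
    (s := {x | P x}) (τ := τ) (by
      have : μ {x | P x}ᶜ = 0 := h
      rw [this]; exact ENNReal.ofReal_pos.2 hτ)
  exact ⟨M, hMc, hMτ, fun x hx => hM hx⟩

theorem measure_lt_norm_le {g : X → ℂ} (hg : AEStronglyMeasurable g μ) {ε : ℝ} (hε : 0 < ε) :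
    μ {x | ε < ‖g x‖} ≤ (eLpNorm g 2 μ / ENNReal.ofReal ε) ^ 2 := by
  have h := meas_ge_le_mul_pow_eLpNorm_enorm μ (p := 2) (by norm_num) (by norm_num) hg
    (ε := ENNReal.ofReal ε) (ENNReal.ofReal_pos.2 hε).ne' (by simp)
  refine (measure_mono fun x hx => ?_).trans (h.trans_eq ?_)
  · have hx' : ε < ‖g x‖ := hx
    change ENNReal.ofReal ε ≤ ‖g x‖ₑ
    rw [← ofReal_norm]
    exact ENNReal.ofReal_le_ofReal hx'.le
  · norm_num
    rw [ENNReal.div_eq_inv_mul, mul_pow]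

/-- A square integrable function is uniformly continuous up to `ε` on compact sets of measure
close to one, because it is close to a continuous function off a set of small measure. -/
theorem onLargeCompacts_uniformContinuous {g : X → ℂ} (hg : MemLp g 2 μ) {ε : ℝ} (hε : 0 < ε) :
    OnLargeCompacts μ fun M => ∃ δ : ℝ, 0 < δ ∧
      ∀ x ∈ M, ∀ y ∈ M, dist x y ≤ δ → ‖g x - g y‖ ≤ ε := by
  intro τ hτ
  -- `κ` is chosen such that `(κ / (ε / 3)) ^ 2 < τ`
  set κ : ℝ := min τ 1 * (ε / 3) / 2 with hκ
  have hκ0 : 0 < κ := by positivity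
  obtain ⟨c, hc, hcm⟩ := hg.exists_boundedContinuous_eLpNorm_sub_le (by norm_num)
    (ε := ENNReal.ofReal κ) (ENNReal.ofReal_pos.2 hκ0).ne'
  have h3 : 0 < ε / 3 := by positivity
  have hbad : μ {x | ‖(g - (c : X → ℂ)) x‖ ≤ ε / 3}ᶜ < ENNReal.ofReal τ := by
    have hset : {x | ‖(g - (c : X → ℂ)) x‖ ≤ ε / 3}ᶜ = {x | ε / 3 < ‖(g - (c : X → ℂ)) x‖} := by
      ext x; simp
    rw [hset]
    refine (measure_lt_norm_le (hg.1.sub hcm.1) h3).trans_lt ?_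
    calc (eLpNorm (g - (c : X → ℂ)) 2 μ / ENNReal.ofReal (ε / 3)) ^ 2
        ≤ (ENNReal.ofReal κ / ENNReal.ofReal (ε / 3)) ^ 2 := by gcongr
      _ = ENNReal.ofReal ((min τ 1 / 2) ^ 2) := by
          rw [← ENNReal.ofReal_div_of_pos h3, ← ENNReal.ofReal_pow (by positivity), hκ]
          congr 2
          field_simp
      _ < ENNReal.ofReal τ := by
          refine (ENNReal.ofReal_lt_ofReal_iff hτ).2 ?_
          have h1 : 0 < min τ 1 := lt_min hτ one_pos
          have h2 := min_le_left τ 1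
          have h4 := min_le_right τ 1
          nlinarith
  obtain ⟨M, hM, hMc, hMτ⟩ := exists_isCompact_subset_of_measure_compl_lt hbad
  obtain ⟨δ, hδ, hδc⟩ := Metric.uniformContinuous_iff.1
    (CompactSpace.uniformContinuous_of_continuous c.continuous) (ε / 3) h3
  refine ⟨M, hMc, hMτ, δ / 2, by positivity, fun x hx y hy hxy => ?_⟩
  have h1 : ‖g x - c x‖ ≤ ε / 3 := hM hx
  have h2 : ‖g y - c y‖ ≤ ε / 3 := hM hy
  have h4 : ‖c x - c y‖ ≤ ε / 3 := by
    rw [← dist_eq_norm]; exact (hδc (by linarith)).le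
  calc ‖g x - g y‖ = ‖(g x - c x) + (c x - c y) - (g y - c y)‖ := by congr 1; ring
    _ ≤ ‖g x - c x‖ + ‖c x - c y‖ + ‖g y - c y‖ :=
        (norm_sub_le _ _).trans (add_le_add_left (norm_add_le _ _) _)
    _ ≤ ε := by linarith

end LargeCompacts

/-! ### Orbits of systems with discrete spectrum -/

section DiscreteSpectrum

variable {G : Type*} [NormedAddCommGroup G] [ProperSpace G] [MeasurableSpace G] [BorelSpace G]
  {ν : Measure G} [ν.IsAddHaarMeasure] {F : ℕ → Set G}
  {X : Type*} [MetricSpace X] [CompactSpace X] [MeasurableSpace X] [BorelSpace X]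
  [AddAction G X] [ContinuousVAdd G X] {μ : Measure X} [IsProbabilityMeasure μ]

/-- On compact sets of measure close to one, nearby points have orbits along which the values of
`g` stay uniformly close, at almost all times. -/
def IsOrbitEquicontinuous (ν : Measure G) (μ : Measure X) (g : X → ℂ) : Prop :=
  ∀ ε : ℝ, 0 < ε → OnLargeCompacts μ fun M => ∃ δ : ℝ, 0 < δ ∧
    ∀ x ∈ M, ∀ y ∈ M, dist x y ≤ δ → ∀ᵐ j : G ∂ν, ‖g (j +ᵥ x) - g (j +ᵥ y)‖ ≤ ε

theorem IsOrbitEquicontinuous.congr_ae (hμ : VAddInvariantMeasure G X μ) {g h : X → ℂ}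
    (hg : IsOrbitEquicontinuous ν μ g) (hgh : g =ᵐ[μ] h) : IsOrbitEquicontinuous ν μ h := by
  intro ε hε
  refine ((hg ε hε).and (onLargeCompacts_of_ae (ae_ae_vadd (ν := ν) hμ hgh)) ?_ ?_).mono ?_
  · rintro M N hMN ⟨δ, hδ, h⟩
    exact ⟨δ, hδ, fun x hx y hy => h x (hMN hx) y (hMN hy)⟩
  · exact fun M N hMN h x hx => h x (hMN hx)
  · rintro M ⟨⟨δ, hδ, h⟩, hM⟩
    refine ⟨δ, hδ, fun x hx y hy hxy => ?_⟩
    filter_upwards [h x hx y hy hxy, hM x hx, hM y hy] with j h1 h2 h3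
    rwa [← h2, ← h3]

theorem IsOrbitEquicontinuous.add {g h : X → ℂ} (hg : IsOrbitEquicontinuous ν μ g)
    (hh : IsOrbitEquicontinuous ν μ h) : IsOrbitEquicontinuous ν μ (g + h) := by
  intro ε hε
  refine ((hg (ε / 2) (by positivity)).and (hh (ε / 2) (by positivity)) ?_ ?_).mono ?_
  · rintro M N hMN ⟨δ, hδ, h⟩
    exact ⟨δ, hδ, fun x hx y hy => h x (hMN hx) y (hMN hy)⟩
  · rintro M N hMN ⟨δ, hδ, h⟩
    exact ⟨δ, hδ, fun x hx y hy => h x (hMN hx) y (hMN hy)⟩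
  · rintro M ⟨⟨δ, hδ, h⟩, ⟨δ', hδ', h'⟩⟩
    refine ⟨min δ δ', lt_min hδ hδ', fun x hx y hy hxy => ?_⟩
    filter_upwards [h x hx y hy (hxy.trans (min_le_left _ _)),
      h' x hx y hy (hxy.trans (min_le_right _ _))] with j h1 h2
    simp only [Pi.add_apply]
    rw [add_sub_add_comm]
    exact (norm_add_le _ _).trans (by linarith)

theorem IsOrbitEquicontinuous.const_smul {g : X → ℂ} (hg : IsOrbitEquicontinuous ν μ g) (c : ℂ) :
    IsOrbitEquicontinuous ν μ (c • g) := by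
  intro ε hε
  refine (hg (ε / (‖c‖ + 1)) (by positivity)).mono ?_
  rintro M ⟨δ, hδ, h⟩
  refine ⟨δ, hδ, fun x hx y hy hxy => ?_⟩
  filter_upwards [h x hx y hy hxy] with j h1
  simp only [Pi.smul_apply]
  rw [← smul_sub, norm_smul]
  rw [le_div_iff₀ (by positivity)] at h1
  nlinarith [norm_nonneg (g (j +ᵥ x) - g (j +ᵥ y))]

theorem isOrbitEquicontinuous_zero : IsOrbitEquicontinuous ν μ (0 : X → ℂ) := fun ε hε =>
  (onLargeCompacts_of_ae (μ := μ) (P := fun _ => True) (by simp)).mono fun _ _ =>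
    ⟨1, one_pos, fun x _ y _ _ => ae_of_all _ fun j => by simpa using hε.le⟩

/-- Along an orbit an eigenfunction only changes by phases, so it suffices that it is uniformly
continuous on large compact sets. -/
theorem isOrbitEquicontinuous_of_eigenfunction {e : X → ℂ} (he : MemLp e 2 μ)
    (hem : StronglyMeasurable e) {χ : G → ℂ} (hχ : Continuous χ) (hχ1 : ∀ j, ‖χ j‖ = 1)
    (heχ : ∀ j : G, (fun x => e (j +ᵥ x)) =ᵐ[μ] fun x => χ j * e x) :
    IsOrbitEquicontinuous ν μ e := by
  intro ε hε
  have hae : ∀ᵐ x ∂μ, ∀ᵐ j : G ∂ν, e (j +ᵥ x) = χ j * e x := by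
    rw [Measure.ae_ae_comm (p := fun x (j : G) => e (j +ᵥ x) = χ j * e x)]
    · exact ae_of_all _ heχ
    · exact measurableSet_eq_fun (hem.measurable.comp measurable_vadd_swap)
        ((hχ.measurable.comp measurable_snd).mul (hem.measurable.comp measurable_fst))
  refine ((onLargeCompacts_uniformContinuous he hε).and (onLargeCompacts_of_ae hae) ?_ ?_).mono ?_
  · rintro M N hMN ⟨δ, hδ, h⟩
    exact ⟨δ, hδ, fun x hx y hy => h x (hMN hx) y (hMN hy)⟩
  · exact fun M N hMN h x hx => h x (hMN hx)
  · rintro M ⟨⟨δ, hδ, h⟩, hM⟩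
    refine ⟨δ, hδ, fun x hx y hy hxy => ?_⟩
    filter_upwards [hM x hx, hM y hy] with j h1 h2
    rw [h1, h2, ← mul_sub, norm_mul, hχ1, one_mul]
    exact h x hx y hy hxy

theorem isOrbitEquicontinuous_of_mem_span (hμ : VAddInvariantMeasure G X μ)
    {s : Set (Lp ℂ 2 μ)} (hs : ∀ e ∈ s, IsOrbitEquicontinuous ν μ e) {h : Lp ℂ 2 μ}
    (hh : h ∈ Submodule.span ℂ s) : IsOrbitEquicontinuous ν μ h := by
  induction hh using Submodule.span_induction with
  | mem e he => exact hs e he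
  | zero => exact isOrbitEquicontinuous_zero.congr_ae hμ (Lp.coeFn_zero _ _ _).symm
  | add g h _ _ hg hh => exact (hg.add hh).congr_ae hμ (Lp.coeFn_add g h).symm
  | smul c g _ hg => exact (hg.const_smul c).congr_ae hμ (Lp.coeFn_smul c g).symm

/-- Discrete spectrum implies mean equicontinuity with respect to `f`: approximate `f` by a linear
combination `h` of eigenfunctions; by the maximal inequality, orbits of most points spend little
time where `f` and `h` are far apart. -/
theorem IsAveragingSequence.onLargeCompacts_densityAlong_lt (hF : IsAveragingSequence ν F)
    (hμ : IsErgodicMeasure G μ) {s : Set (Lp ℂ 2 μ)}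
    (hs : ∀ e ∈ s, IsOrbitEquicontinuous ν μ e) {f : X → ℂ} (hf : MemLp f 2 μ)
    (hfs : hf.toLp f ∈ closure (Submodule.span ℂ s : Set (Lp ℂ 2 μ))) {ε : ℝ} (hε : 0 < ε) :
    OnLargeCompacts μ fun M => ∃ δ : ℝ, 0 < δ ∧ ∀ x ∈ M, ∀ y ∈ M, dist x y ≤ δ →
      densityAlong ν F {j : G | ε < ‖f (j +ᵥ x) - f (j +ᵥ y)‖} < ENNReal.ofReal ε := by
  obtain ⟨K, hKt, hK⟩ := hF.exists_densityAlong_returnTimes_le (μ := μ) hμ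
  have hε4 : 0 < ε / 4 := by positivity
  set k : ℝ := K.toReal + 1 with hk
  have hk0 : 0 < k := by positivity
  -- `κ` is chosen such that `k * (κ / (ε / 4)) ^ 2 ≤ ε / 4`
  set κ : ℝ := min 1 (ε / (4 * k)) * (ε / 4) with hκ
  have hκ0 : 0 < κ := by positivity
  obtain ⟨h, hhs, hfh⟩ := Metric.mem_closure_iff.1 hfs κ hκ0
  set f' : Lp ℂ 2 μ := hf.toLp f with hf'
  set B : Set X := {x | ε / 4 < ‖f' x - h x‖} with hB
  have hBm : MeasurableSet B :=
    measurableSet_lt measurable_const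
      ((Lp.stronglyMeasurable f').sub (Lp.stronglyMeasurable h)).norm.measurable
  have hμB : μ B ≤ ENNReal.ofReal ((κ / (ε / 4)) ^ 2) := by
    refine (measure_lt_norm_le (g := fun x => f' x - h x)
      ((Lp.aestronglyMeasurable f').sub (Lp.aestronglyMeasurable h)) hε4).trans ?_
    have h1 : eLpNorm (fun x => f' x - h x) 2 μ ≤ ENNReal.ofReal κ := by
      rw [dist_eq_norm, Lp.norm_def, eLpNorm_congr_ae (Lp.coeFn_sub f' h)] at hfh
      refine (ENNReal.le_ofReal_iff_toReal_le ?_ hκ0.le).2 hfh.le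
      exact (((Lp.memLp f').sub (Lp.memLp h))).2.ne
    calc (eLpNorm (fun x => f' x - h x) 2 μ / ENNReal.ofReal (ε / 4)) ^ 2
        ≤ (ENNReal.ofReal κ / ENNReal.ofReal (ε / 4)) ^ 2 := by gcongr
      _ = _ := by
          rw [← ENNReal.ofReal_div_of_pos hε4, ← ENNReal.ofReal_pow (by positivity)]
  have hKB : K * μ B ≤ ENNReal.ofReal (ε / 4) := by
    calc K * μ B ≤ ENNReal.ofReal k * ENNReal.ofReal ((κ / (ε / 4)) ^ 2) := by
          refine mul_le_mul' ?_ hμB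
          refine (ENNReal.le_ofReal_iff_toReal_le hKt hk0.le).2 (by linarith)
      _ = ENNReal.ofReal (k * (κ / (ε / 4)) ^ 2) := (ENNReal.ofReal_mul hk0.le).symm
      _ ≤ ENNReal.ofReal (ε / 4) := by
          refine ENNReal.ofReal_le_ofReal ?_
          have h1 : κ / (ε / 4) = min 1 (ε / (4 * k)) := by
            rw [hκ, mul_div_assoc, div_self hε4.ne', mul_one]
          rw [h1]
          have h2 := min_le_left 1 (ε / (4 * k))
          have h3 := min_le_right 1 (ε / (4 * k))
          have h4 : 0 < min 1 (ε / (4 * k)) := by positivity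
          calc k * min 1 (ε / (4 * k)) ^ 2 ≤ k * (1 * (ε / (4 * k))) := by
                rw [sq]; gcongr
            _ = ε / 4 := by field_simp
  have hfae : ∀ᵐ x ∂μ, ∀ᵐ j : G ∂ν, f (j +ᵥ x) = f' (j +ᵥ x) :=
    ae_ae_vadd hμ.1 hf.coeFn_toLp.symm
  have hanti : ∀ P : X → Prop, ∀ M N : Set X, M ⊆ N → (∀ x ∈ N, P x) → ∀ x ∈ M, P x :=
    fun P M N hMN h x hx => h x (hMN hx)
  refine ((isOrbitEquicontinuous_of_mem_span hμ.1 hs hhs (ε / 4) hε4).and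
    (onLargeCompacts_of_ae (hfae.and (hK B hBm))) ?_ (hanti _)).mono ?_
  · rintro M N hMN ⟨δ, hδ, h⟩
    exact ⟨δ, hδ, fun x hx y hy => h x (hMN hx) y (hMN hy)⟩
  rintro M ⟨⟨δ, hδ, hM⟩, hM'⟩
  refine ⟨δ, hδ, fun x hx y hy hxy => ?_⟩
  have hsub : {j : G | ε < ‖f (j +ᵥ x) - f (j +ᵥ y)‖} ≤ᵐ[ν]
      (returnTimes G B x ∪ returnTimes G B y : Set G) := by
    filter_upwards [hM x hx y hy hxy, (hM' x hx).1, (hM' y hy).1] with j h1 h2 h3 hj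
    by_contra hcon
    have hcon1 : ¬ ε / 4 < ‖f' (j +ᵥ x) - h (j +ᵥ x)‖ := fun hc => hcon (Or.inl hc)
    have hcon2 : ¬ ε / 4 < ‖f' (j +ᵥ y) - h (j +ᵥ y)‖ := fun hc => hcon (Or.inr hc)
    have hj' : ε < ‖f (j +ᵥ x) - f (j +ᵥ y)‖ := hj
    rw [h2, h3] at hj'
    have h4 : ‖f' (j +ᵥ x) - f' (j +ᵥ y)‖ ≤ ‖f' (j +ᵥ x) - h (j +ᵥ x)‖ +
        ‖h (j +ᵥ x) - h (j +ᵥ y)‖ + ‖f' (j +ᵥ y) - h (j +ᵥ y)‖ := by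
      calc _ = ‖(f' (j +ᵥ x) - h (j +ᵥ x)) + (h (j +ᵥ x) - h (j +ᵥ y)) -
            (f' (j +ᵥ y) - h (j +ᵥ y))‖ := by congr 1; ring
        _ ≤ _ := (norm_sub_le _ _).trans (add_le_add_left (norm_add_le _ _) _)
    linarith
  calc densityAlong ν F {j : G | ε < ‖f (j +ᵥ x) - f (j +ᵥ y)‖}
      ≤ densityAlong ν F (returnTimes G B x) + densityAlong ν F (returnTimes G B y) :=
        (densityAlong_mono_ae hsub).trans (densityAlong_union_le _ _)
    _ ≤ ENNReal.ofReal (ε / 4) + ENNReal.ofReal (ε / 4) :=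
        add_le_add ((hM' x hx).2.trans hKB) ((hM' y hy).2.trans hKB)
    _ = ENNReal.ofReal (ε / 2) := by
        rw [← ENNReal.ofReal_add hε4.le hε4.le]; congr 1; ring
    _ < ENNReal.ofReal ε := (ENNReal.ofReal_lt_ofReal_iff hε).2 (by linarith)

end DiscreteSpectrum

/-! ### Orthonormal bases of joint eigenvectors -/

section Eigenbasis

theorem mem_orthogonal_span_iff {H : Type*} [NormedAddCommGroup H] [InnerProductSpace ℂ H]
    {s : Set H} {v : H} : v ∈ (Submodule.span ℂ s)ᗮ ↔ ∀ u ∈ s, ⟪u, v⟫_ℂ = 0 := by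
  rw [Submodule.mem_orthogonal]
  refine ⟨fun h u hu => h u (Submodule.subset_span hu), fun h u hu => ?_⟩
  induction hu using Submodule.span_induction with
  | mem u hu => exact h u hu
  | zero => exact inner_zero_left _
  | add u w _ _ hu hw => rw [inner_add_left, hu, hw, add_zero]
  | smul c u _ hu => rw [inner_smul_left, hu, mul_zero]

variable {G : Type*} [AddCommGroup G] [TopologicalSpace G]
  {H : Type*} [NormedAddCommGroup H] [InnerProductSpace ℂ H]
  {U : G → H →ₗᵢ[ℂ] H}

/-- A joint eigenvector defines a continuous unitary character of the group. -/
theorem IsUnitaryRep.exists_character (hU : IsUnitaryRep U) {v : H} (hv : v ≠ 0)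
    (h : ∀ j, ∃ c : ℂ, U j v = c • v) :
    ∃ χ : G → ℂ, Continuous χ ∧ (∀ j, ‖χ j‖ = 1) ∧ (∀ i j, χ (i + j) = χ i * χ j) ∧
      ∀ j, U j v = χ j • v := by
  choose χ hχ using h
  have hn : ‖v‖ ≠ 0 := norm_ne_zero_iff.2 hv
  refine ⟨χ, ?_, fun j => ?_, fun i j => ?_, hχ⟩
  · have h1 : χ = fun j => ⟪v, U j v⟫_ℂ / ⟪v, v⟫_ℂ := by
      ext j
      rw [hχ, inner_smul_right, mul_div_cancel_right₀ _ (inner_self_ne_zero.2 hv)]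
    rw [h1]
    exact (continuous_const.inner (hU.cont v)).div_const _
  · have h1 := (U j).norm_map v
    rw [hχ, norm_smul] at h1
    exact (mul_eq_right₀ hn).1 h1
  · have h1 : χ (i + j) • v = (χ i * χ j) • v := by
      rw [← hχ, hU.add, hχ j, map_smul, hχ i, smul_smul, mul_comm]
    exact smul_left_injective ℂ hv h1

/-- If every nonzero closed invariant subspace contains a joint eigenvector, then there is an
orthonormal basis of joint eigenvectors: take a maximal orthonormal set of such vectors. -/
theorem IsUnitaryRep.exists_hilbertBasis [CompleteSpace H] (hU : IsUnitaryRep U)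
    (h : ∀ V : Submodule ℂ H, IsClosed (V : Set H) → (∀ j, ∀ v ∈ V, U j v ∈ V) →
      (∀ v ∈ V, v ≠ 0 → ¬ ∀ j, ∃ c : ℂ, U j v = c • v) → V = ⊥) :
    ∃ (s : Set H) (b : HilbertBasis s ℂ H), (∀ f : s, b f = f) ∧
      ∀ f ∈ s, f ≠ 0 ∧ ∀ j, ∃ c : ℂ, U j f = c • f := by
  set 𝒮 : Set (Set H) := {s | Orthonormal ℂ (Subtype.val : s → H) ∧
    ∀ f ∈ s, ∀ j, ∃ c : ℂ, U j f = c • f} with h𝒮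
  obtain ⟨s, hs⟩ : ∃ s, Maximal (· ∈ 𝒮) s := by
    refine zorn_subset 𝒮 fun c hc hchain =>
      ⟨⋃₀ c, ⟨?_, ?_⟩, fun t ht => Set.subset_sUnion_of_mem ht⟩
    · exact orthonormal_sUnion_of_directed hchain.directedOn fun t ht => (hc ht).1
    · rintro f ⟨t, ht, hf⟩
      exact (hc ht).2 f hf
  have hso := hs.prop.1
  have hse := hs.prop.2
  have hV : (Submodule.span ℂ s)ᗮ = ⊥ := by
    refine h _ (Submodule.isClosed_orthogonal _) (fun j v hv => ?_) fun v hv hv0 hvc => ?_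
    · rw [mem_orthogonal_span_iff] at hv ⊢
      intro u hu
      obtain ⟨c, hc⟩ := hse u hu (-j)
      rw [← inner_eq_zero_symm, hU.inner_map_left, hc, inner_smul_right,
        inner_eq_zero_symm.1 (hv u hu), mul_zero]
    · have hn : ‖v‖ ≠ 0 := norm_ne_zero_iff.2 hv0
      set u : H := ((‖v‖⁻¹ : ℝ) : ℂ) • v with hu
      have hu1 : ‖u‖ = 1 := by rw [hu, norm_smul]; simp [hn]
      have huV : u ∈ (Submodule.span ℂ s)ᗮ := Submodule.smul_mem _ _ hv
      rw [mem_orthogonal_span_iff] at huV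
      have hmem : insert u s ∈ 𝒮 := by
        constructor
        · constructor
          · rintro ⟨w, rfl | hw⟩
            · exact hu1
            · exact hso.1 ⟨w, hw⟩
          · rintro ⟨w, hw⟩ ⟨w', hw'⟩ hne
            have hne' : w ≠ w' := fun h => hne (Subtype.ext h)
            change ⟪w, w'⟫_ℂ = 0
            rcases hw with hw | hw <;> rcases hw' with hw' | hw'
            · exact absurd (hw.trans hw'.symm) hne'
            · rw [hw]; exact inner_eq_zero_symm.1 (huV w' hw')
            · rw [hw']; exact huV w hw
            · exact hso.2 (i := ⟨w, hw⟩) (j := ⟨w', hw'⟩) (fun h => hne' (congrArg Subtype.val h))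
        · rintro w (rfl | hw)
          · intro j
            obtain ⟨c, hc⟩ := hvc j
            exact ⟨c, by rw [hu, map_smul, hc, smul_comm]⟩
          · exact hse w hw
      have hus : u ∈ s := hs.le_of_ge hmem (Set.subset_insert _ _) (Set.mem_insert _ _)
      have h0 := huV u hus
      rw [inner_self_eq_zero] at h0
      simp [h0] at hu1
  refine ⟨s, HilbertBasis.mkOfOrthogonalEqBot hso (by rwa [Subtype.range_coe]), fun f => ?_,
    fun f hf => ⟨?_, hse f hf⟩⟩
  · rw [HilbertBasis.coe_mkOfOrthogonalEqBot]
  · exact hso.ne_zero ⟨f, hf⟩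

end Eigenbasis

/-! ### The Koopman representation -/

section Koopman

variable {G : Type*} [NormedAddCommGroup G] [ProperSpace G] [MeasurableSpace G] [BorelSpace G]
  {X : Type*} [MetricSpace X] [CompactSpace X] [MeasurableSpace X] [BorelSpace X]
  [AddAction G X] [ContinuousVAdd G X] {μ : Measure X} [IsProbabilityMeasure μ]

/-- The Koopman representation `f ↦ f ∘ T^j` on `L²`. -/
noncomputable def koopman (hμ : VAddInvariantMeasure G X μ) (j : G) :
    Lp ℂ 2 μ →ₗᵢ[ℂ] Lp ℂ 2 μ :=
  Lp.compMeasurePreservingₗᵢ ℂ (fun x => j +ᵥ x) (measurePreserving_vadd j μ)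

theorem koopman_coeFn (hμ : VAddInvariantMeasure G X μ) (j : G) (f : Lp ℂ 2 μ) :
    koopman hμ j f =ᵐ[μ] fun x => f (j +ᵥ x) :=
  Lp.coeFn_compMeasurePreserving f (measurePreserving_vadd j μ)

theorem isUnitaryRep_koopman (hμ : VAddInvariantMeasure G X μ) :
    IsUnitaryRep (koopman (G := G) hμ) where
  zero v := by
    refine Lp.ext ((koopman_coeFn hμ 0 v).trans (.of_forall fun x => ?_))
    simp only [zero_vadd]
  add i j v := by
    have h1 := (measurePreserving_vadd i μ).quasiMeasurePreserving.ae_eq_comp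
      (koopman_coeFn hμ j v)
    refine Lp.ext ((koopman_coeFn hμ (i + j) v).trans
      ((koopman_coeFn hμ i (koopman hμ j v)).trans (h1.trans (.of_forall fun x => ?_))).symm)
    change v (j +ᵥ (i +ᵥ x)) = v ((i + j) +ᵥ x)
    rw [vadd_vadd, add_comm]
  cont v := by
    let g : G → C(X, X) := fun j => ⟨fun x => j +ᵥ x, continuous_const_vadd j⟩
    have hg : Continuous g :=
      (ContinuousMap.curry ⟨fun p : G × X => p.1 +ᵥ p.2, continuous_vadd⟩).continuous
    exact Continuous.compMeasurePreservingLp (f := fun _ : G => v) continuous_const hg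
      (fun j => measurePreserving_vadd j μ) (by norm_num)

/-- The class of a continuous function in `L²`. -/
noncomputable def contL2 (μ : Measure X) [IsProbabilityMeasure μ] (f : C(X, ℂ)) : Lp ℂ 2 μ :=
  ContinuousMap.toLp 2 μ ℂ f

theorem contL2_coeFn (f : C(X, ℂ)) : contL2 μ f =ᵐ[μ] f := ContinuousMap.coeFn_toLp μ f

theorem koopman_contL2_coeFn (hμ : VAddInvariantMeasure G X μ) (j : G) (f : C(X, ℂ)) :
    koopman hμ j (contL2 μ f) =ᵐ[μ] fun x => f (j +ᵥ x) :=
  (koopman_coeFn hμ j _).trans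
    ((measurePreserving_vadd j μ).quasiMeasurePreserving.ae_eq_comp (contL2_coeFn f))

/-- The class of the indicator function of a measurable set in `L²`. -/
noncomputable def indL2 (μ : Measure X) [IsProbabilityMeasure μ] {A : Set X}
    (hA : MeasurableSet A) : Lp ℂ 2 μ :=
  indicatorConstLp 2 hA (measure_ne_top μ A) (1 : ℂ)

theorem inner_indL2 {A : Set X} (hA : MeasurableSet A) (f : Lp ℂ 2 μ) :
    ⟪indL2 μ hA, f⟫_ℂ = ∫ x in A, f x ∂μ :=
  L2.inner_indicatorConstLp_one hA (measure_ne_top μ A) f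

theorem inner_indL2_koopman_contL2 (hμ : VAddInvariantMeasure G X μ) {A : Set X}
    (hA : MeasurableSet A) (j : G) (f : C(X, ℂ)) :
    ⟪indL2 μ hA, koopman hμ j (contL2 μ f)⟫_ℂ = ∫ x in A, f (j +ᵥ x) ∂μ := by
  rw [inner_indL2]
  exact integral_congr_ae (ae_restrict_of_ae (koopman_contL2_coeFn hμ j f))

theorem norm_indL2_sq {A : Set X} (hA : MeasurableSet A) : ‖indL2 μ hA‖ ^ 2 = μ.real A := by
  rw [indL2, norm_indicatorConstLp (by norm_num) (by norm_num)]
  simp only [norm_one, one_mul, ENNReal.toReal_ofNat]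
  rw [← Real.sqrt_eq_rpow, Real.sq_sqrt measureReal_nonneg]

/-- For an ergodic measure, the invariant vectors of the Koopman representation are the
constants. -/
theorem exists_ae_eq_const_of_koopman_eq (ν : Measure G) [ν.IsAddHaarMeasure]
    (hμ : IsErgodicMeasure G μ) {ψ : Lp ℂ 2 μ} (hψ : ∀ j : G, koopman hμ.1 j ψ = ψ) :
    ∃ c : ℂ, ψ =ᵐ[μ] fun _ => c := by
  refine exists_eventuallyEq_const_of_forall_separating MeasurableSet fun S hS => ?_
  have hm : MeasurableSet (ψ ⁻¹' S) := (Lp.stronglyMeasurable ψ).measurable hS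
  have hinv : ∀ g : G, ∀ᵐ x ∂μ, g +ᵥ x ∈ ψ ⁻¹' S ↔ x ∈ ψ ⁻¹' S := by
    intro g
    have h1 := koopman_coeFn hμ.1 g ψ
    rw [hψ g] at h1
    filter_upwards [h1] with x hx
    simp only [Set.mem_preimage, hx]
  rcases measure_eq_zero_or_one_of_ae_invariant ν hμ hm hinv with h | h
  · exact Or.inr (measure_eq_zero_iff_ae_notMem.1 h)
  · exact Or.inl ((prob_compl_eq_zero_iff hm).2 h)

/-- **Weak mean ergodic theorem.** For an ergodic measure, matrix coefficients of the Koopman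
representation have the mean `⟪k, 1⟫ * ⟪1, φ⟫`. -/
theorem mean_matrixCoeff_koopman (ν : Measure G) [ν.IsAddHaarMeasure] (hμ : IsErgodicMeasure G μ)
    {m : (G →ᵇ ℂ) →ₗ[ℂ] ℂ} (hm : IsInvariantMean m) (k φ : Lp ℂ 2 μ) :
    m ((isUnitaryRep_koopman hμ.1).matrixCoeff k φ) =
      ⟪k, contL2 μ 1⟫_ℂ * ⟪contL2 μ 1, φ⟫_ℂ := by
  set hU := isUnitaryRep_koopman (G := G) hμ.1 with hU'
  -- the functional `φ ↦ m (matrixCoeff k φ)` is represented by an invariant vector `ψ`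
  let ℓ : Lp ℂ 2 μ →L[ℂ] ℂ := LinearMap.mkContinuous
    { toFun := fun φ => m (hU.matrixCoeff k φ)
      map_add' := fun φ φ' => by
        rw [← map_add]; congr 1; ext j; simp
      map_smul' := fun c φ => by
        rw [RingHom.id_apply, ← map_smul]; congr 1; ext j; simp } ‖k‖
    fun φ => (hm.norm_le _).trans (hU.norm_matrixCoeff_le k φ)
  set ψ : Lp ℂ 2 μ := (InnerProductSpace.toDual ℂ _).symm ℓ with hψ
  have hψℓ : ∀ φ, ⟪ψ, φ⟫_ℂ = m (hU.matrixCoeff k φ) := fun φ =>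
    InnerProductSpace.toDual_symm_apply
  have hinv : ∀ j : G, koopman hμ.1 j ψ = ψ := by
    intro i
    refine ext_inner_right ℂ fun w => ?_
    rw [hU.inner_map_left, hψℓ, hψℓ, ← hm.translate (hU.matrixCoeff k w) (-i)]
    congr 1
    ext j
    simp [hU.add]
  obtain ⟨c, hc⟩ := exists_ae_eq_const_of_koopman_eq ν hμ hinv
  have hψc : ψ = c • contL2 μ 1 := by
    refine Lp.ext (hc.trans ?_)
    filter_upwards [Lp.coeFn_smul c (contL2 μ 1), contL2_coeFn (μ := μ) 1] with x h1 h2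
    rw [h1, Pi.smul_apply, h2]; simp
  have h11 : ⟪contL2 μ (1 : C(X, ℂ)), contL2 μ 1⟫_ℂ = 1 := by
    have h1 : indL2 μ MeasurableSet.univ = contL2 μ (1 : C(X, ℂ)) := by
      refine Lp.ext ?_
      filter_upwards [indicatorConstLp_coeFn_mem (p := 2) (hs := MeasurableSet.univ)
        (hμs := measure_ne_top μ Set.univ) (c := (1 : ℂ)), contL2_coeFn (μ := μ) 1] with x hx hx'
      rw [hx']
      exact hx trivial
    have h2 := norm_indL2_sq (μ := μ) MeasurableSet.univ
    rw [probReal_univ, h1] at h2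
    rw [inner_self_eq_norm_sq_to_K, ← RCLike.ofReal_pow, h2, RCLike.ofReal_one]
  have h1inv : ∀ j : G, koopman hμ.1 j (contL2 μ 1) = contL2 μ 1 := by
    intro j
    refine Lp.ext ((koopman_contL2_coeFn hμ.1 j 1).trans (contL2_coeFn (μ := μ) 1).symm)
  have hk : ⟪ψ, contL2 μ 1⟫_ℂ = ⟪k, contL2 μ 1⟫_ℂ := by
    have h1 : hU.matrixCoeff k (contL2 μ 1) = ⟪k, contL2 μ 1⟫_ℂ • 1 := by
      ext j
      simp [h1inv j]
    rw [hψℓ, h1, map_smul, hm.map_one, smul_eq_mul, mul_one]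
  rw [← hψℓ, ← hk, hψc, inner_smul_left, inner_smul_left, h11, mul_one]

end Koopman

/-! ### The energy of a function on a set -/

section Energy

variable {G : Type*} [NormedAddCommGroup G] [ProperSpace G] [MeasurableSpace G] [BorelSpace G]
  {ν : Measure G} [ν.IsAddHaarMeasure] {F : ℕ → Set G}
  {X : Type*} [MetricSpace X] [CompactSpace X] [MeasurableSpace X] [BorelSpace X]
  [AddAction G X] [ContinuousVAdd G X] {μ : Measure X} [IsProbabilityMeasure μ]

theorem integrable_of_continuous {Y : Type*} [TopologicalSpace Y] [CompactSpace Y]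
    [MeasurableSpace Y] [OpensMeasurableSpace Y] {ρ : Measure Y} [IsFiniteMeasure ρ]
    {E : Type*} [NormedAddCommGroup E] [SecondCountableTopologyEither Y E]
    {f : Y → E} (hf : Continuous f) : Integrable f ρ :=
  hf.integrable_of_hasCompactSupport (HasCompactSupport.of_compactSpace f)

theorem integral_prod_norm_sub_sq (ρ : Measure X) [IsFiniteMeasure ρ] {h : X → ℂ}
    (hh : Continuous h) :
    ∫ p, ‖h p.1 - h p.2‖ ^ 2 ∂(ρ.prod ρ) =
      2 * (ρ.real Set.univ * ∫ x, ‖h x‖ ^ 2 ∂ρ) - 2 * ‖∫ x, h x ∂ρ‖ ^ 2 := by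
  have e : ∀ p : X × X, ‖h p.1 - h p.2‖ ^ 2 = ‖h p.1‖ ^ 2 * 1 + 1 * ‖h p.2‖ ^ 2 -
      2 * (h p.1 * (starRingEnd ℂ) (h p.2)).re := by
    intro p
    rw [Complex.sq_norm, Complex.sq_norm, Complex.sq_norm, Complex.normSq_sub]; ring
  have c1 : Continuous fun p : X × X => h p.1 := hh.comp continuous_fst
  have c2 : Continuous fun p : X × X => h p.2 := hh.comp continuous_snd
  have i3 : Integrable (fun p : X × X => h p.1 * (starRingEnd ℂ) (h p.2)) (ρ.prod ρ) :=
    integrable_of_continuous (c1.mul (Complex.continuous_conj.comp c2))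
  have e3 : ∫ p : X × X, (h p.1 * (starRingEnd ℂ) (h p.2)).re ∂(ρ.prod ρ) =
      ‖∫ x, h x ∂ρ‖ ^ 2 := by
    have h1 : ∫ p : X × X, (h p.1 * (starRingEnd ℂ) (h p.2)).re ∂(ρ.prod ρ) =
        (∫ p : X × X, h p.1 * (starRingEnd ℂ) (h p.2) ∂(ρ.prod ρ)).re :=
      integral_re (𝕜 := ℂ) i3
    rw [h1, integral_prod_mul h fun y => (starRingEnd ℂ) (h y), integral_conj, Complex.mul_conj']
    norm_cast
  simp_rw [e]
  rw [integral_sub, integral_add, integral_prod_mul (fun x => ‖h x‖ ^ 2) (fun _ => (1 : ℝ)),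
    integral_prod_mul (fun _ => (1 : ℝ)) (fun x => ‖h x‖ ^ 2), integral_const_mul, e3]
  · simp only [integral_const, smul_eq_mul, mul_one]; ring
  · exact integrable_of_continuous (by fun_prop)
  · exact integrable_of_continuous (by fun_prop)
  · exact integrable_of_continuous (by fun_prop)
  · exact (i3.re).const_mul 2

/-- The energy `j ↦ ∫∫_{A × A} |f (T^j x) - f (T^j y)|²`, in terms of matrix coefficients of the
Koopman representation. -/
noncomputable def energy (hμ : VAddInvariantMeasure G X μ) {A : Set X} (hA : MeasurableSet A)
    (f : C(X, ℂ)) : G →ᵇ ℂ :=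
  ((2 * μ.real A : ℝ) : ℂ) •
      (isUnitaryRep_koopman hμ).matrixCoeff (indL2 μ hA) (contL2 μ (f * star f)) -
    (2 : ℂ) • ((isUnitaryRep_koopman hμ).matrixCoeff (indL2 μ hA) (contL2 μ f) *
      star ((isUnitaryRep_koopman hμ).matrixCoeff (indL2 μ hA) (contL2 μ f)))

theorem inner_indL2_koopman_mul_star (hμ : VAddInvariantMeasure G X μ) {A : Set X}
    (hA : MeasurableSet A) (f : C(X, ℂ)) (j : G) :
    ⟪indL2 μ hA, koopman hμ j (contL2 μ (f * star f))⟫_ℂ =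
      ((∫ x in A, ‖f (j +ᵥ x)‖ ^ 2 ∂μ : ℝ) : ℂ) := by
  rw [inner_indL2_koopman_contL2, ← integral_complex_ofReal]
  refine integral_congr_ae (.of_forall fun x => ?_)
  change f (j +ᵥ x) * (starRingEnd ℂ) (f (j +ᵥ x)) = _
  rw [Complex.mul_conj']
  norm_cast

theorem re_energy (hμ : VAddInvariantMeasure G X μ) {A : Set X} (hA : MeasurableSet A)
    (f : C(X, ℂ)) (j : G) : (energy hμ hA f j).re =
      ∫ p, ‖f (j +ᵥ p.1) - f (j +ᵥ p.2)‖ ^ 2 ∂((μ.restrict A).prod (μ.restrict A)) := by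
  rw [integral_prod_norm_sub_sq (μ.restrict A) (h := fun x => f (j +ᵥ x))
    (f.continuous.comp (continuous_const_vadd j))]
  have h1 : energy hμ hA f j = ((2 * μ.real A : ℝ) : ℂ) *
      ⟪indL2 μ hA, koopman hμ j (contL2 μ (f * star f))⟫_ℂ -
      2 * (⟪indL2 μ hA, koopman hμ j (contL2 μ f)⟫_ℂ *
        (starRingEnd ℂ) ⟪indL2 μ hA, koopman hμ j (contL2 μ f)⟫_ℂ) := rfl
  rw [h1, inner_indL2_koopman_mul_star, Complex.mul_conj', inner_indL2_koopman_contL2,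
    measureReal_restrict_apply_univ, ← Complex.ofReal_mul, ← Complex.ofReal_pow,
    show (2 : ℂ) = ((2 : ℝ) : ℂ) by norm_num, ← Complex.ofReal_mul, ← Complex.ofReal_sub,
    Complex.ofReal_re, mul_assoc]

/-- The Besicovitch pseudometric along a sequence of sets. -/
noncomputable def besicovitchAlong (ν : Measure G) (F : ℕ → Set G) (x y : X) : ℝ≥0∞ :=
  limsup (fun n => (∫⁻ j in F n, edist (j +ᵥ x) (j +ᵥ y) ∂ν) / ν (F n)) atTop

/-- A continuous function on a compact space is Lipschitz up to a small error. -/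
theorem exists_norm_sub_sq_le (f : C(X, ℂ)) {η : ℝ} (hη : 0 < η) :
    ∃ C : ℝ, 0 ≤ C ∧ ∀ x y, ‖f x - f y‖ ^ 2 ≤ η + C * dist x y := by
  obtain ⟨δ, hδ, hδf⟩ := Metric.uniformContinuous_iff.1
    (CompactSpace.uniformContinuous_of_continuous f.continuous) (Real.sqrt η) (Real.sqrt_pos.2 hη)
  refine ⟨(2 * ‖f‖) ^ 2 / δ, by positivity, fun x y => ?_⟩
  rcases lt_or_ge (dist x y) δ with h | h
  · have h1 := hδf h
    rw [dist_eq_norm] at h1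
    have h2 : ‖f x - f y‖ ^ 2 ≤ η := by
      rw [← Real.sq_sqrt hη.le]
      exact pow_le_pow_left₀ (norm_nonneg _) h1.le 2
    have : 0 ≤ (2 * ‖f‖) ^ 2 / δ * dist x y := by positivity
    linarith
  · have h1 : ‖f x - f y‖ ≤ 2 * ‖f‖ := by
      have := norm_sub_le (f x) (f y)
      have := f.norm_coe_le_norm x
      have := f.norm_coe_le_norm y
      linarith
    have h2 : ‖f x - f y‖ ^ 2 ≤ (2 * ‖f‖) ^ 2 := pow_le_pow_left₀ (norm_nonneg _) h1 2
    have h3 : (2 * ‖f‖) ^ 2 ≤ (2 * ‖f‖) ^ 2 / δ * dist x y := by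
      rw [div_mul_eq_mul_div, le_div_iff₀ hδ]
      gcongr
    linarith

/-- If points of `A` are pairwise close in the Besicovitch pseudometric, then the average over
`F n` of the integral of `d(T^j x, T^j y)` over `A × A` is asymptotically small, by the reverse
Fatou lemma. -/
theorem limsup_lintegral_edist_le {A : Set X}
    (hA : MeasurableSet A) {ε : ℝ≥0∞} (hε : ∀ x ∈ A, ∀ y ∈ A, besicovitchAlong ν F x y ≤ ε) :
    limsup (fun n => (∫⁻ j in F n, ∫⁻ p : X × X, edist (j +ᵥ p.1) (j +ᵥ p.2)
      ∂((μ.restrict A).prod (μ.restrict A)) ∂ν) / ν (F n)) atTop ≤ ε * μ A ^ 2 := by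
  set P : Measure (X × X) := (μ.restrict A).prod (μ.restrict A) with hP
  have hcont : Continuous fun q : (X × X) × G => edist (q.2 +ᵥ q.1.1) (q.2 +ᵥ q.1.2) := by
    fun_prop
  have hswap : ∀ n, (∫⁻ j in F n, ∫⁻ p : X × X, edist (j +ᵥ p.1) (j +ᵥ p.2) ∂P ∂ν) / ν (F n) =
      ∫⁻ p : X × X, (∫⁻ j in F n, edist (j +ᵥ p.1) (j +ᵥ p.2) ∂ν) / ν (F n) ∂P := by
    intro n
    rw [← lintegral_lintegral_swap (μ := P) (f := fun (p : X × X) (j : G) =>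
      edist (j +ᵥ p.1) (j +ᵥ p.2)) hcont.measurable.aemeasurable]
    simp_rw [div_eq_mul_inv]
    rw [lintegral_mul_const]
    exact Measurable.lintegral_prod_right' (f := fun q : (X × X) × G =>
      edist (q.2 +ᵥ q.1.1) (q.2 +ᵥ q.1.2)) hcont.measurable
  simp_rw [hswap]
  have hdiam : Metric.ediam (Set.univ : Set X) ≠ ∞ :=
    (isCompact_univ : IsCompact (Set.univ : Set X)).isBounded.ediam_ne_top
  refine (limsup_lintegral_le (fun _ => Metric.ediam (Set.univ : Set X)) (fun n => ?_)
    (fun n => .of_forall fun p => ?_) ?_).trans ?_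
  · exact (Measurable.lintegral_prod_right' (f := fun q : (X × X) × G =>
      edist (q.2 +ᵥ q.1.1) (q.2 +ᵥ q.1.2)) hcont.measurable).div_const _
  · refine ENNReal.div_le_of_le_mul ?_
    refine (lintegral_mono fun j => Metric.edist_le_ediam_of_mem (Set.mem_univ _)
      (Set.mem_univ _)).trans_eq ?_
    rw [setLIntegral_const]
  · rw [lintegral_const]
    exact ENNReal.mul_ne_top hdiam (MeasureTheory.measure_ne_top _ _)
  · have hae : ∀ᵐ p : X × X ∂P, p ∈ A ×ˢ A := by
      rw [hP, Measure.prod_restrict]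
      exact ae_restrict_mem (hA.prod hA)
    calc ∫⁻ p : X × X, limsup (fun n => (∫⁻ j in F n, edist (j +ᵥ p.1) (j +ᵥ p.2) ∂ν) /
          ν (F n)) atTop ∂P ≤ ∫⁻ _, ε ∂P := by
          refine lintegral_mono_ae ?_
          filter_upwards [hae] with p hp
          exact hε p.1 hp.1 p.2 hp.2
      _ = ε * μ A ^ 2 := by
          rw [lintegral_const, hP, ← Set.univ_prod_univ, Measure.prod_prod,
            Measure.restrict_apply_univ, sq]

/-- If the action is not mean sensitive, then the mean energy of `f` on a suitable set of positive
measure is small compared to the square of the measure of the set. -/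
theorem IsAveragingSequence.exists_mean_energy_le (hF : IsAveragingSequence ν F)
    (hμ : VAddInvariantMeasure G X μ) {m : (G →ᵇ ℂ) →ₗ[ℂ] ℂ} {𝒰 : Ultrafilter ℕ}
    (h𝒰 : (𝒰 : Filter ℕ) ≤ atTop)
    (hm : ∀ φ : G →ᵇ ℂ, Tendsto (fun n => ⨍ j in F n, φ j ∂ν) 𝒰 (𝓝 (m φ)))
    (hns : ∀ ε : ℝ, 0 < ε → ∃ A : Set X, MeasurableSet A ∧ 0 < μ A ∧
      ∀ x ∈ A, ∀ y ∈ A, besicovitchAlong ν F x y ≤ ENNReal.ofReal ε)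
    (f : C(X, ℂ)) {κ : ℝ} (hκ : 0 < κ) :
    ∃ (A : Set X) (hA : MeasurableSet A), 0 < μ A ∧
      (m (energy hμ hA f)).re ≤ κ * μ.real A ^ 2 := by
  obtain ⟨C, hC0, hC⟩ := exists_norm_sub_sq_le f (half_pos hκ)
  -- `ε` is chosen such that `C * (2 * ε) ≤ κ / 2`
  set ε : ℝ := κ / (4 * (C + 1)) with hε
  have hε0 : 0 < ε := by positivity
  obtain ⟨A, hA, hA0, hAε⟩ := hns ε hε0
  refine ⟨A, hA, hA0, ?_⟩
  set P : Measure (X × X) := (μ.restrict A).prod (μ.restrict A) with hP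
  have ha0 : 0 < μ.real A := ENNReal.toReal_pos hA0.ne' (MeasureTheory.measure_ne_top _ _)
  have hPr : P.real Set.univ = μ.real A ^ 2 := by
    rw [hP, ← Set.univ_prod_univ, measureReal_prod_prod, measureReal_restrict_apply_univ, sq]
  have hcont : Continuous fun q : G × (X × X) => edist (q.1 +ᵥ q.2.1) (q.1 +ᵥ q.2.2) := by
    fun_prop
  set I : G → ℝ≥0∞ := fun j => ∫⁻ p : X × X, edist (j +ᵥ p.1) (j +ᵥ p.2) ∂P with hI
  have hIm : Measurable I := hcont.measurable.lintegral_prod_right'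
  have hIr : ∀ j, (I j).toReal = ∫ p : X × X, dist (j +ᵥ p.1) (j +ᵥ p.2) ∂P := by
    intro j
    rw [integral_eq_lintegral_of_nonneg_ae (.of_forall fun p => dist_nonneg)
      (by fun_prop : Continuous fun p : X × X =>
        dist (j +ᵥ p.1) (j +ᵥ p.2)).aestronglyMeasurable]
    simp_rw [hI, edist_dist]
  have hdiam : Metric.ediam (Set.univ : Set X) ≠ ∞ :=
    (isCompact_univ : IsCompact (Set.univ : Set X)).isBounded.ediam_ne_top
  have hIb : ∀ j, I j ≤ Metric.ediam (Set.univ : Set X) * P Set.univ := by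
    intro j
    refine (lintegral_mono fun p => Metric.edist_le_ediam_of_mem (Set.mem_univ _)
      (Set.mem_univ _)).trans_eq ?_
    rw [lintegral_const]
  have hIfin : ∀ n, ∫⁻ j in F n, I j ∂ν ≠ ∞ := by
    intro n
    refine ((lintegral_mono fun j => hIb j).trans_lt ?_).ne
    rw [setLIntegral_const]
    exact ENNReal.mul_lt_top (ENNReal.mul_lt_top hdiam.lt_top (measure_lt_top _ _))
      (hF.measure_ne_top n).lt_top
  have hpt : ∀ j, (energy hμ hA f j).re ≤ κ / 2 * μ.real A ^ 2 + C * (I j).toReal := by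
    intro j
    rw [re_energy, hIr]
    have h1 : ∫ p : X × X, (κ / 2 + C * dist (j +ᵥ p.1) (j +ᵥ p.2)) ∂P =
        κ / 2 * μ.real A ^ 2 + C * ∫ p : X × X, dist (j +ᵥ p.1) (j +ᵥ p.2) ∂P := by
      rw [integral_add (integrable_const _) (integrable_of_continuous (by fun_prop)),
        integral_const, integral_const_mul, hPr, smul_eq_mul, mul_comm (μ.real A ^ 2)]
    rw [← h1]
    exact integral_mono (integrable_of_continuous (by fun_prop))
      (integrable_of_continuous (by fun_prop)) fun p => hC _ _
  have havg : ∀ n, ν (F n) ≠ 0 → (⨍ j in F n, energy hμ hA f j ∂ν).re ≤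
      κ / 2 * μ.real A ^ 2 + C * ((∫⁻ j in F n, I j ∂ν) / ν (F n)).toReal := by
    intro n hn
    have hfin := hF.measure_ne_top n
    have hνr : 0 < ν.real (F n) := ENNReal.toReal_pos hn hfin
    have hint : IntegrableOn (energy hμ hA f) (F n) ν :=
      Measure.integrableOn_of_bounded (M := ‖energy hμ hA f‖) hfin
        (energy hμ hA f).continuous.aestronglyMeasurable
        (ae_of_all _ fun j => (energy hμ hA f).norm_coe_le_norm j)
    have hre : (∫ j in F n, energy hμ hA f j ∂ν).re = ∫ j in F n, (energy hμ hA f j).re ∂ν :=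
      (integral_re (𝕜 := ℂ) hint).symm
    have hIint : IntegrableOn (fun j => (I j).toReal) (F n) ν :=
      integrable_toReal_of_lintegral_ne_top hIm.aemeasurable (hIfin n)
    have hconst : IntegrableOn (fun _ : G => κ / 2 * μ.real A ^ 2) (F n) ν :=
      integrableOn_const hfin
    have hle : ∫ j in F n, (energy hμ hA f j).re ∂ν ≤
        κ / 2 * μ.real A ^ 2 * ν.real (F n) + C * (∫⁻ j in F n, I j ∂ν).toReal := by
      refine (integral_mono hint.re (hconst.add (hIint.const_mul C)) hpt).trans_eq ?_
      rw [integral_add' hconst (hIint.const_mul C), integral_const_mul C, setIntegral_const,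
        integral_toReal hIm.aemeasurable
          (.of_forall fun j => (hIb j).trans_lt
            (ENNReal.mul_lt_top hdiam.lt_top (measure_lt_top _ _))), smul_eq_mul, mul_comm]
    rw [setAverage_eq, Complex.smul_re, hre, smul_eq_mul, ENNReal.toReal_div, ← div_eq_inv_mul,
      div_le_iff₀ hνr]
    refine hle.trans_eq ?_
    rw [← measureReal_def]
    field_simp
  have hlim : ∀ᶠ n in (𝒰 : Filter ℕ), (∫⁻ j in F n, I j ∂ν) / ν (F n) <
      ENNReal.ofReal (2 * ε * μ.real A ^ 2) := by
    refine h𝒰 (eventually_lt_of_limsup_lt ((limsup_lintegral_edist_le hA hAε).trans_lt ?_))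
    have h1 : μ A ^ 2 = ENNReal.ofReal (μ.real A ^ 2) := by
      rw [ENNReal.ofReal_pow measureReal_nonneg, ofReal_measureReal]
    rw [h1, ← ENNReal.ofReal_mul hε0.le]
    refine (ENNReal.ofReal_lt_ofReal_iff (by positivity)).2 ?_
    have : 0 < ε * μ.real A ^ 2 := by positivity
    linarith
  refine le_of_tendsto ((Complex.continuous_re.tendsto _).comp (hm (energy hμ hA f))) ?_
  filter_upwards [hlim, h𝒰 (eventually_ne_atTop 0)] with n hn hn0
  refine (havg n (hF.measure_ne_zero n hn0)).trans ?_
  have h1 : ((∫⁻ j in F n, I j ∂ν) / ν (F n)).toReal ≤ 2 * ε * μ.real A ^ 2 :=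
    ENNReal.toReal_le_of_le_ofReal (by positivity) hn.le
  have h2 : C * (2 * ε) ≤ κ / 2 := by
    rw [hε]
    have : C / (C + 1) ≤ 1 := (div_le_one (by positivity)).2 (by linarith)
    calc C * (2 * (κ / (4 * (C + 1)))) = κ / 2 * (C / (C + 1)) := by field_simp; norm_num
      _ ≤ κ / 2 * 1 := by gcongr
      _ = κ / 2 := mul_one _
  calc κ / 2 * μ.real A ^ 2 + C * ((∫⁻ j in F n, I j ∂ν) / ν (F n)).toReal
      ≤ κ / 2 * μ.real A ^ 2 + C * (2 * ε * μ.real A ^ 2) := by gcongr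
    _ = κ / 2 * μ.real A ^ 2 + C * (2 * ε) * μ.real A ^ 2 := by ring
    _ ≤ κ / 2 * μ.real A ^ 2 + κ / 2 * μ.real A ^ 2 := by gcongr
    _ = κ * μ.real A ^ 2 := by ring

end Energy

/-! ### Quadratic means of matrix coefficients -/

section MeanSquare

variable {G : Type*} [AddCommGroup G] [TopologicalSpace G] [IsTopologicalAddGroup G]
  {H : Type*} [NormedAddCommGroup H] [InnerProductSpace ℂ H]
  {U : G → H →ₗᵢ[ℂ] H} {m : (G →ᵇ ℂ) →ₗ[ℂ] ℂ}

/-- The quadratic mean of the matrix coefficient `⟪k, U j v⟫`. -/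
noncomputable def meanSq (hU : IsUnitaryRep U) (m : (G →ᵇ ℂ) →ₗ[ℂ] ℂ) (k v : H) : ℝ :=
  (m (hU.matrixCoeff k v * star (hU.matrixCoeff k v))).re

theorem re_matrixCoeff_mul_star (hU : IsUnitaryRep U) (k v : H) (j : G) :
    ((hU.matrixCoeff k v * star (hU.matrixCoeff k v)) j).re = ‖⟪k, U j v⟫_ℂ‖ ^ 2 := by
  change (⟪k, U j v⟫_ℂ * (starRingEnd ℂ) ⟪k, U j v⟫_ℂ).re = _
  rw [Complex.mul_conj']
  norm_cast

theorem continuous_meanSq (hU : IsUnitaryRep U) (hm : IsInvariantMean m) (k : H) :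
    Continuous (meanSq hU m k) := by
  have h1 : Continuous fun v => hU.matrixCoeff k v := by
    refine (LipschitzWith.of_dist_le_mul (K := ‖k‖₊) fun v w => ?_).continuous
    have : hU.matrixCoeff k v - hU.matrixCoeff k w = hU.matrixCoeff k (v - w) := by
      ext j; simp
    rw [dist_eq_norm, dist_eq_norm, this]
    exact hU.norm_matrixCoeff_le k _
  have h2 : Continuous m :=
    (LinearMap.mkContinuous m 1 fun φ => by rw [one_mul]; exact hm.norm_le φ).continuous
  exact Complex.continuous_re.comp (h2.comp (h1.mul h1.star))

/-- A vector with vanishing quadratic mean can be added without increasing the quadratic mean. -/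
theorem meanSq_add_le (hU : IsUnitaryRep U) (hm : IsInvariantMean m) (k : H) {v w : H}
    (hw : meanSq hU m k w = 0) : meanSq hU m k (v + w) ≤ meanSq hU m k v := by
  have key : ∀ s : ℝ, 0 < s → meanSq hU m k (v + w) ≤ (1 + s) * meanSq hU m k v := by
    intro s hs
    have h1 := hm.re_mono
      (φ := hU.matrixCoeff k (v + w) * star (hU.matrixCoeff k (v + w)))
      (ψ := ((1 + s : ℝ) : ℂ) • (hU.matrixCoeff k v * star (hU.matrixCoeff k v)) +
        ((1 + s⁻¹ : ℝ) : ℂ) • (hU.matrixCoeff k w * star (hU.matrixCoeff k w))) fun j => by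
      rw [BoundedContinuousFunction.add_apply, BoundedContinuousFunction.smul_apply,
        BoundedContinuousFunction.smul_apply, Complex.add_re, smul_eq_mul, smul_eq_mul,
        Complex.re_ofReal_mul, Complex.re_ofReal_mul, re_matrixCoeff_mul_star,
        re_matrixCoeff_mul_star, re_matrixCoeff_mul_star, map_add, inner_add_right]
      set a := ‖⟪k, U j v⟫_ℂ‖
      set b := ‖⟪k, U j w⟫_ℂ‖
      have h2 : ‖⟪k, U j v⟫_ℂ + ⟪k, U j w⟫_ℂ‖ ^ 2 ≤ (a + b) ^ 2 :=
        pow_le_pow_left₀ (norm_nonneg _) (norm_add_le _ _) 2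
      have h3 : 0 ≤ (s * a - b) ^ 2 * s⁻¹ := by positivity
      have h4 : (s * a - b) ^ 2 * s⁻¹ = s * a ^ 2 - 2 * a * b + s⁻¹ * b ^ 2 := by
        field_simp
        ring
      nlinarith
    rw [map_add, map_smul, map_smul, Complex.add_re, smul_eq_mul, smul_eq_mul,
      Complex.re_ofReal_mul, Complex.re_ofReal_mul] at h1
    have h5 : (m (hU.matrixCoeff k w * star (hU.matrixCoeff k w))).re = 0 := hw
    rw [h5, mul_zero, add_zero] at h1
    exact h1
  have hlim : Tendsto (fun s : ℝ => (1 + s) * meanSq hU m k v) (𝓝[>] 0)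
      (𝓝 ((1 + 0) * meanSq hU m k v)) :=
    ((tendsto_const_nhds.add tendsto_id).mul_const _).mono_left nhdsWithin_le_nhds
  rw [add_zero, one_mul] at hlim
  exact ge_of_tendsto hlim (eventually_mem_nhdsWithin.mono fun s hs => key s hs)

end MeanSquare

/-! ### Eigenvectors in the absence of sensitivity -/

section Sensitive

variable {G : Type*} [NormedAddCommGroup G] [ProperSpace G] [MeasurableSpace G] [BorelSpace G]
  {ν : Measure G} [ν.IsAddHaarMeasure] {F : ℕ → Set G}
  {X : Type*} [MetricSpace X] [CompactSpace X] [MeasurableSpace X] [BorelSpace X]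
  [AddAction G X] [ContinuousVAdd G X] {μ : Measure X} [IsProbabilityMeasure μ]

theorem norm_contL2_sq (f : C(X, ℂ)) : ‖contL2 μ f‖ ^ 2 = ∫ x, ‖f x‖ ^ 2 ∂μ := by
  have h1 : ((‖contL2 μ f‖ ^ 2 : ℝ) : ℂ) = ((∫ x, ‖f x‖ ^ 2 ∂μ : ℝ) : ℂ) := by
    have h2 : ⟪contL2 μ f, contL2 μ f⟫_ℂ = ((‖contL2 μ f‖ ^ 2 : ℝ) : ℂ) := by
      rw [inner_self_eq_norm_sq_to_K]; norm_cast
    rw [← h2, L2.inner_def, ← integral_complex_ofReal]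
    refine integral_congr_ae ?_
    filter_upwards [contL2_coeFn (μ := μ) f] with x hx
    rw [hx, inner_self_eq_norm_sq_to_K]
    norm_cast
  exact_mod_cast h1

theorem inner_indL2_one {A : Set X} (hA : MeasurableSet A) :
    ⟪indL2 μ hA, contL2 μ 1⟫_ℂ = (μ.real A : ℂ) := by
  rw [inner_indL2, integral_congr_ae (ae_restrict_of_ae (contL2_coeFn (μ := μ) 1))]
  simp

theorem inner_one_contL2_mul_star (f : C(X, ℂ)) :
    ⟪contL2 μ 1, contL2 μ (f * star f)⟫_ℂ = ((‖contL2 μ f‖ ^ 2 : ℝ) : ℂ) := by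
  rw [norm_contL2_sq, L2.inner_def, ← integral_complex_ofReal]
  refine integral_congr_ae ?_
  filter_upwards [contL2_coeFn (μ := μ) 1, contL2_coeFn (μ := μ) (f * star f)] with x h1 h2
  rw [h1, h2]
  change inner ℂ (1 : ℂ) (f x * (starRingEnd ℂ) (f x)) = _
  rw [Complex.mul_conj']
  simp

theorem mean_matrixCoeff_mul_star (ν : Measure G) [ν.IsAddHaarMeasure]
    (hμ : IsErgodicMeasure G μ) {m : (G →ᵇ ℂ) →ₗ[ℂ] ℂ} (hm : IsInvariantMean m) {A : Set X}
    (hA : MeasurableSet A) (f : C(X, ℂ)) :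
    m ((isUnitaryRep_koopman hμ.1).matrixCoeff (indL2 μ hA) (contL2 μ (f * star f))) =
      ((μ.real A * ‖contL2 μ f‖ ^ 2 : ℝ) : ℂ) := by
  rw [mean_matrixCoeff_koopman ν hμ hm, inner_indL2_one, inner_one_contL2_mul_star,
    ← Complex.ofReal_mul]

/-- Correlations with the indicator function of `A` satisfy a Cauchy-Schwarz bound with the square
of the measure of `A` in the quadratic mean. -/
theorem meanSq_indL2_le (ν : Measure G) [ν.IsAddHaarMeasure] (hμ : IsErgodicMeasure G μ)
    {m : (G →ᵇ ℂ) →ₗ[ℂ] ℂ} (hm : IsInvariantMean m) {A : Set X} (hA : MeasurableSet A)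
    (v : Lp ℂ 2 μ) :
    meanSq (isUnitaryRep_koopman hμ.1) m (indL2 μ hA) v ≤ μ.real A ^ 2 * ‖v‖ ^ 2 := by
  set hU := isUnitaryRep_koopman (G := G) hμ.1
  have hdense : DenseRange (contL2 (X := X) μ) :=
    ContinuousMap.toLp_denseRange ℂ μ ℂ (by norm_num)
  -- both sides are continuous in `v`, so `v` may be assumed continuous
  refine hdense.induction_on (p := fun v => meanSq hU m (indL2 μ hA) v ≤ μ.real A ^ 2 * ‖v‖ ^ 2)
    v (isClosed_le (continuous_meanSq hU hm _) (by fun_prop)) fun f => ?_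
  have h1 := hm.re_mono
    (φ := hU.matrixCoeff (indL2 μ hA) (contL2 μ f) *
      star (hU.matrixCoeff (indL2 μ hA) (contL2 μ f)))
    (ψ := (μ.real A : ℂ) • hU.matrixCoeff (indL2 μ hA) (contL2 μ (f * star f))) fun j => by
    -- the energy of `f` on `A` is nonnegative
    have h2 : 0 ≤ (energy hμ.1 hA f j).re := by
      rw [re_energy]; exact integral_nonneg fun p => by positivity
    have h3 : (energy hμ.1 hA f j).re =
        2 * ((μ.real A : ℂ) • hU.matrixCoeff (indL2 μ hA) (contL2 μ (f * star f)) j).re -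
        2 * ((hU.matrixCoeff (indL2 μ hA) (contL2 μ f) *
          star (hU.matrixCoeff (indL2 μ hA) (contL2 μ f))) j).re := by
      have e : energy hμ.1 hA f j = ((2 * μ.real A : ℝ) : ℂ) *
          hU.matrixCoeff (indL2 μ hA) (contL2 μ (f * star f)) j - ((2 : ℝ) : ℂ) *
          (hU.matrixCoeff (indL2 μ hA) (contL2 μ f) *
            star (hU.matrixCoeff (indL2 μ hA) (contL2 μ f))) j := rfl
      rw [e, Complex.sub_re, Complex.re_ofReal_mul, Complex.re_ofReal_mul, smul_eq_mul,
        Complex.re_ofReal_mul]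
      ring
    rw [BoundedContinuousFunction.smul_apply]
    linarith
  refine h1.trans_eq ?_
  rw [map_smul, mean_matrixCoeff_mul_star ν hμ hm hA f, smul_eq_mul, ← Complex.ofReal_mul,
    Complex.ofReal_re]
  ring

/-- If the action is not mean sensitive, then every nonzero closed invariant subspace of `L²`
contains a joint eigenvector. Otherwise the component `g` of a continuous function in such a
subspace is weakly mixing, so it contributes `2 ‖g‖²` to the normalized mean energy on every set of
positive measure. -/
theorem IsAveragingSequence.eq_bot_of_forall_not_eigenvector (hF : IsAveragingSequence ν F)
    (hμ : IsErgodicMeasure G μ)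
    (hns : ∀ ε : ℝ, 0 < ε → ∃ A : Set X, MeasurableSet A ∧ 0 < μ A ∧
      ∀ x ∈ A, ∀ y ∈ A, besicovitchAlong ν F x y ≤ ENNReal.ofReal ε)
    (V : Submodule ℂ (Lp ℂ 2 μ)) (hVc : IsClosed (V : Set (Lp ℂ 2 μ)))
    (hV : ∀ j : G, ∀ v ∈ V, koopman hμ.1 j v ∈ V)
    (hne : ∀ v ∈ V, v ≠ 0 → ¬ ∀ j : G, ∃ c : ℂ, koopman hμ.1 j v = c • v) : V = ⊥ := by
  set hU := isUnitaryRep_koopman (G := G) hμ.1 with hUdef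
  obtain ⟨m, 𝒰, hm, h𝒰, hlim⟩ := hF.exists_isInvariantMean
  have hcompl : CompleteSpace V := hVc.completeSpace_coe
  have hproj : ∀ f : C(X, ℂ), V.starProjection (contL2 μ f) = 0 := by
    intro f
    set g := V.starProjection (contL2 μ f) with hg
    set p := contL2 μ f - g with hp
    have hgV : g ∈ V := Submodule.starProjection_apply_mem _ _
    have hpg : ‖contL2 μ f‖ ^ 2 = ‖p‖ ^ 2 + ‖g‖ ^ 2 := by
      have hpV : p ∈ Vᗮ := Submodule.sub_starProjection_mem_orthogonal _
      have h1 : ⟪p, g⟫_ℂ = 0 := (Submodule.mem_orthogonal' V p).1 hpV g hgV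
      have h2 := norm_add_sq_eq_norm_sq_add_norm_sq_of_inner_eq_zero p g h1
      rw [hp, sub_add_cancel] at h2
      rw [sq, sq, sq, h2]
    have hle : ∀ κ : ℝ, 0 < κ → 2 * ‖g‖ ^ 2 ≤ κ := by
      intro κ hκ
      obtain ⟨A, hA, hA0, hAκ⟩ := hF.exists_mean_energy_le hμ.1 h𝒰 hlim hns f hκ
      have ha0 : 0 < μ.real A := ENNReal.toReal_pos hA0.ne' (MeasureTheory.measure_ne_top _ _)
      have hg0 : meanSq hU m (indL2 μ hA) g = 0 := by
        rw [meanSq, hU.mean_matrixCoeff_mul_star_eq_zero hm V hVc hV hne hgV, Complex.zero_re]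
      have hN : meanSq hU m (indL2 μ hA) (contL2 μ f) ≤ μ.real A ^ 2 * ‖p‖ ^ 2 := by
        have h1 := meanSq_add_le hU hm (indL2 μ hA) (v := p) hg0
        rw [hp, sub_add_cancel] at h1
        exact h1.trans (meanSq_indL2_le ν hμ hm hA p)
      have hE : (m (energy hμ.1 hA f)).re = 2 * μ.real A * (μ.real A * ‖contL2 μ f‖ ^ 2) -
          2 * meanSq hU m (indL2 μ hA) (contL2 μ f) := by
        have e : m (energy hμ.1 hA f) = ((2 * μ.real A : ℝ) : ℂ) *
            m (hU.matrixCoeff (indL2 μ hA) (contL2 μ (f * star f))) - ((2 : ℝ) : ℂ) *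
            m (hU.matrixCoeff (indL2 μ hA) (contL2 μ f) *
              star (hU.matrixCoeff (indL2 μ hA) (contL2 μ f))) := by
          rw [energy, map_sub, map_smul, map_smul, smul_eq_mul, smul_eq_mul]
          norm_num
        rw [e, Complex.sub_re, Complex.re_ofReal_mul, Complex.re_ofReal_mul,
          mean_matrixCoeff_mul_star ν hμ hm hA f, Complex.ofReal_re]
        rfl
      have h3 : μ.real A ^ 2 * (2 * ‖g‖ ^ 2) ≤ μ.real A ^ 2 * κ := by
        rw [hE, hpg] at hAκ
        nlinarith
      exact le_of_mul_le_mul_left h3 (by positivity)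
    have h0 : 2 * ‖g‖ ^ 2 ≤ 0 := le_of_forall_pos_le_add fun κ hκ => by
      rw [zero_add]; exact hle κ hκ
    have h1 : ‖g‖ ^ 2 = 0 := le_antisymm (by linarith) (by positivity)
    exact norm_eq_zero.1 (pow_eq_zero_iff two_ne_zero |>.1 h1)
  have hdense : DenseRange (contL2 (X := X) μ) :=
    ContinuousMap.toLp_denseRange ℂ μ ℂ (by norm_num)
  rw [Submodule.eq_bot_iff]
  intro v hv
  rw [← Submodule.starProjection_eq_self_iff.2 hv]
  exact hdense.induction_on (p := fun v => V.starProjection v = 0) v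
    (isClosed_eq V.starProjection.continuous continuous_const) hproj

end Sensitive

/-! ### The equivalence along an averaging sequence -/

section Equivalence

variable {G : Type*} [NormedAddCommGroup G] [ProperSpace G] [MeasurableSpace G] [BorelSpace G]
  {ν : Measure G} [ν.IsAddHaarMeasure] {F : ℕ → Set G}
  {X : Type*} [MetricSpace X] [CompactSpace X] [MeasurableSpace X] [BorelSpace X]
  [AddAction G X] [ContinuousVAdd G X] {μ : Measure X} [IsProbabilityMeasure μ]

/-- The pseudometric `ρ_f` along a sequence of sets. -/
noncomputable def rhoAlong (ν : Measure G) (F : ℕ → Set G) (f : X → ℂ) (x y : X) : ℝ :=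
  sInf {ε : ℝ | 0 < ε ∧
    densityAlong ν F {j | ε < ‖f (j +ᵥ x) - f (j +ᵥ y)‖} < ENNReal.ofReal ε}

theorem rhoAlong_le {f : X → ℂ} {x y : X} {ε : ℝ} (hε : 0 < ε)
    (h : densityAlong ν F {j | ε < ‖f (j +ᵥ x) - f (j +ᵥ y)‖} < ENNReal.ofReal ε) :
    rhoAlong ν F f x y ≤ ε :=
  csInf_le ⟨0, fun _ hε' => hε'.1.le⟩ ⟨hε, h⟩

theorem densityAlong_le_of_rhoAlong_lt {f : X → ℂ} {x y : X} {ε : ℝ}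
    (h : rhoAlong ν F f x y < ε) :
    densityAlong ν F {j | ε < ‖f (j +ᵥ x) - f (j +ᵥ y)‖} ≤ ENNReal.ofReal ε := by
  -- the set defining `rhoAlong` contains `2`, since upper densities are at most one
  have hne : {ε : ℝ | 0 < ε ∧ densityAlong ν F {j | ε < ‖f (j +ᵥ x) - f (j +ᵥ y)‖} <
      ENNReal.ofReal ε}.Nonempty :=
    ⟨2, two_pos, (densityAlong_le_one _).trans_lt (by norm_num)⟩
  obtain ⟨ε', ⟨_, hε'⟩, hlt⟩ := exists_lt_of_csInf_lt hne h
  refine (densityAlong_mono fun j hj => ?_).trans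
    (hε'.le.trans (ENNReal.ofReal_le_ofReal hlt.le))
  exact hlt.trans hj

/-- It suffices to find the large compact sets for each `ε` separately. -/
theorem onLargeCompacts_forall_pos {D : ℝ → X → X → Prop}
    (hD : ∀ ε ε' x y, ε ≤ ε' → D ε x y → D ε' x y)
    (h : ∀ ε : ℝ, 0 < ε → OnLargeCompacts μ fun M => ∃ δ : ℝ, 0 < δ ∧
      ∀ x ∈ M, ∀ y ∈ M, dist x y ≤ δ → D ε x y) :
    OnLargeCompacts μ fun M => ∀ ε : ℝ, 0 < ε → ∃ δ : ℝ, 0 < δ ∧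
      ∀ x ∈ M, ∀ y ∈ M, dist x y ≤ δ → D ε x y := by
  refine (OnLargeCompacts.forall (ι := ℕ) (P := fun k M => ∃ δ : ℝ, 0 < δ ∧
      ∀ x ∈ M, ∀ y ∈ M, dist x y ≤ δ → D (1 / ((k : ℝ) + 1)) x y) ?_ fun k =>
        h _ (by positivity)).mono fun M hM ε hε => ?_
  · rintro k M N hMN ⟨δ, hδ, hN⟩
    exact ⟨δ, hδ, fun x hx y hy => hN x (hMN hx) y (hMN hy)⟩
  · obtain ⟨k, hk⟩ := exists_nat_one_div_lt hε
    obtain ⟨δ, hδ, hM'⟩ := hM k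
    exact ⟨δ, hδ, fun x hx y hy hxy => hD _ _ _ _ hk.le (hM' x hx y hy hxy)⟩

theorem densityAlong_iUnion_le {ι : Type*} [Fintype ι] (S : ι → Set G) :
    densityAlong ν F (⋃ i, S i) ≤ ∑ i, densityAlong ν F (S i) := by
  classical
  have h : ∀ s : Finset ι, densityAlong ν F (⋃ i ∈ s, S i) ≤ ∑ i ∈ s, densityAlong ν F (S i) := by
    intro s
    induction s using Finset.induction_on with
    | empty => simp [densityAlong]
    | insert i s hi ih =>
      rw [Finset.set_biUnion_insert, Finset.sum_insert hi]
      exact (densityAlong_union_le _ _).trans (by gcongr)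
  simpa using h Finset.univ

/-- If two orbits are `r`-close outside a set of times `S`, then their Besicovitch distance is
bounded in terms of `r` and of the upper density of `S`. -/
theorem besicovitchAlong_le {x y : X} {S : Set G} (hS : MeasurableSet S) {r : ℝ≥0∞}
    (h : ∀ j ∉ S, edist (j +ᵥ x) (j +ᵥ y) ≤ r) :
    besicovitchAlong ν F x y ≤ r + Metric.ediam (Set.univ : Set X) * densityAlong ν F S := by
  have hdiam : Metric.ediam (Set.univ : Set X) ≠ ∞ :=
    (isCompact_univ : IsCompact (Set.univ : Set X)).isBounded.ediam_ne_top
  set D := Metric.ediam (Set.univ : Set X) with hD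
  have hpt : ∀ j : G, edist (j +ᵥ x) (j +ᵥ y) ≤ r + S.indicator (fun _ => D) j := by
    intro j
    by_cases hj : j ∈ S
    · rw [Set.indicator_of_mem hj]
      exact (Metric.edist_le_ediam_of_mem (Set.mem_univ _) (Set.mem_univ _)).trans le_add_self
    · exact (h j hj).trans le_self_add
  have hn : ∀ n, (∫⁻ j in F n, edist (j +ᵥ x) (j +ᵥ y) ∂ν) / ν (F n) ≤
      r + D * (ν (S ∩ F n) / ν (F n)) := by
    intro n
    have h1 : ∫⁻ j in F n, edist (j +ᵥ x) (j +ᵥ y) ∂ν ≤ r * ν (F n) + D * ν (S ∩ F n) := by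
      refine (lintegral_mono hpt).trans_eq ?_
      rw [lintegral_add_left measurable_const, setLIntegral_const, lintegral_indicator hS,
        setLIntegral_const, Measure.restrict_apply hS]
    refine (ENNReal.div_le_div_right h1 _).trans ?_
    rw [ENNReal.add_div, mul_div_assoc, mul_div_assoc]
    gcongr
    calc r * (ν (F n) / ν (F n)) ≤ r * 1 := by gcongr; exact ENNReal.div_self_le_one
      _ = r := mul_one r
  refine (limsup_le_limsup (.of_forall hn)).trans ((ennreal_limsup_add_le _ _).trans ?_)
  rw [limsup_const, ENNReal.limsup_const_mul_of_ne_top hdiam]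
  rfl

/-- Mean equicontinuity with respect to indicator functions implies mean equicontinuity: two orbits
that visit the same members of a finite cover by small balls are close. -/
theorem onLargeCompacts_besicovitchAlong_le_of_indicator
    (h : ∀ B : Set X, MeasurableSet B → OnLargeCompacts μ fun M => ∀ ε : ℝ, 0 < ε →
      ∃ δ : ℝ, 0 < δ ∧ ∀ x ∈ M, ∀ y ∈ M, dist x y ≤ δ →
        rhoAlong ν F (B.indicator fun _ => (1 : ℂ)) x y ≤ ε) {ε : ℝ} (hε : 0 < ε) :
    OnLargeCompacts μ fun M => ∃ δ : ℝ, 0 < δ ∧ ∀ x ∈ M, ∀ y ∈ M, dist x y ≤ δ →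
      besicovitchAlong ν F x y ≤ ENNReal.ofReal ε := by
  have hdiam : Metric.ediam (Set.univ : Set X) ≠ ∞ :=
    (isCompact_univ : IsCompact (Set.univ : Set X)).isBounded.ediam_ne_top
  obtain ⟨t, -, htf, htc⟩ := finite_cover_balls_of_compact
    (isCompact_univ : IsCompact (Set.univ : Set X)) (show (0 : ℝ) < ε / 4 by positivity)
  have : Fintype t := htf.fintype
  set B : t → Set X := fun i => Metric.ball (i : X) (ε / 4) with hB
  have hBm : ∀ i, MeasurableSet (B i) := fun i => Metric.isOpen_ball.measurableSet
  set D : ℝ := (Metric.ediam (Set.univ : Set X)).toReal with hD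
  have hD0 : 0 ≤ D := ENNReal.toReal_nonneg
  set N : ℝ := ((Fintype.card t : ℕ) : ℝ) with hN
  have hN0 : 0 ≤ N := Nat.cast_nonneg _
  -- `θ < 1`, so indicator functions that are `θ`-close agree; and `D * (N * θ) ≤ ε / 2`
  set θ : ℝ := min (1 / 2) (ε / (2 * (D * N + 1))) with hθ
  have hθ0 : 0 < θ := by positivity
  refine (OnLargeCompacts.forall (P := fun (i : t) M => ∀ ε : ℝ, 0 < ε →
      ∃ δ : ℝ, 0 < δ ∧ ∀ x ∈ M, ∀ y ∈ M, dist x y ≤ δ →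
        rhoAlong ν F ((B i).indicator fun _ => (1 : ℂ)) x y ≤ ε) ?_ fun i => h _ (hBm i)).mono
    fun M hM => ?_
  · intro i M M' hMM' hM' ε hε
    obtain ⟨δ, hδ, hδ'⟩ := hM' ε hε
    exact ⟨δ, hδ, fun x hx y hy => hδ' x (hMM' hx) y (hMM' hy)⟩
  choose δ hδ hM using fun i => hM i (θ / 2) (by positivity)
  obtain ⟨δ₀, hδ₀, hδ₀0⟩ : ∃ δ₀ : ℝ, (∀ i, δ₀ ≤ δ i) ∧ 0 < δ₀ :=
    ((eventually_all.2 fun i => (nhdsWithin_le_nhds (eventually_le_nhds (hδ i)) :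
      ∀ᶠ δ₀ in 𝓝[>] (0 : ℝ), δ₀ ≤ δ i)).and eventually_mem_nhdsWithin).exists
  refine ⟨δ₀, hδ₀0, fun x hx y hy hxy => ?_⟩
  set S : t → Set G := fun i => {j | θ < ‖(B i).indicator (fun _ => (1 : ℂ)) (j +ᵥ x) -
    (B i).indicator (fun _ => (1 : ℂ)) (j +ᵥ y)‖} with hS
  have hind : ∀ i, Measurable ((B i).indicator fun _ => (1 : ℂ)) := fun i =>
    measurable_const.indicator (hBm i)
  have horb : ∀ x : X, Measurable fun j : G => j +ᵥ x := fun x =>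
    (continuous_id.vadd continuous_const).measurable
  have hSm : MeasurableSet (⋃ i, S i) := MeasurableSet.iUnion fun i =>
    measurableSet_lt measurable_const
      (((hind i).comp (horb x)).sub ((hind i).comp (horb y))).norm
  have hSd : ∀ i, densityAlong ν F (S i) ≤ ENNReal.ofReal θ := fun i =>
    densityAlong_le_of_rhoAlong_lt
      ((hM i x hx y hy (hxy.trans (hδ₀ i))).trans_lt (half_lt_self hθ0))
  have hclose : ∀ j ∉ ⋃ i, S i, edist (j +ᵥ x) (j +ᵥ y) ≤ ENNReal.ofReal (ε / 2) := by
    intro j hj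
    obtain ⟨i, hit, hi⟩ := Set.mem_iUnion₂.1 (htc (Set.mem_univ (j +ᵥ x)))
    have hyi : j +ᵥ y ∈ B ⟨i, hit⟩ := by
      by_contra hcon
      refine hj (Set.mem_iUnion.2 ⟨⟨i, hit⟩, ?_⟩)
      change θ < _
      rw [Set.indicator_of_mem (show j +ᵥ x ∈ B ⟨i, hit⟩ from hi),
        Set.indicator_of_notMem hcon, sub_zero, norm_one]
      exact (min_le_left _ _).trans_lt (by norm_num)
    rw [edist_dist]
    refine ENNReal.ofReal_le_ofReal ((dist_triangle_right _ _ i).trans ?_)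
    have h1 : dist (j +ᵥ x) i < ε / 4 := hi
    have h2 : dist (j +ᵥ y) i < ε / 4 := hyi
    linarith
  refine (besicovitchAlong_le hSm hclose).trans ?_
  have hdens : densityAlong ν F (⋃ i, S i) ≤ ENNReal.ofReal (N * θ) := by
    refine (densityAlong_iUnion_le S).trans ((Finset.sum_le_sum fun i _ => hSd i).trans_eq ?_)
    rw [Finset.sum_const, Finset.card_univ, nsmul_eq_mul, ENNReal.ofReal_mul hN0, hN,
      ENNReal.ofReal_natCast]
  calc ENNReal.ofReal (ε / 2) + Metric.ediam (Set.univ : Set X) * densityAlong ν F (⋃ i, S i)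
      ≤ ENNReal.ofReal (ε / 2) + ENNReal.ofReal D * ENNReal.ofReal (N * θ) := by
        gcongr
        rw [hD, ENNReal.ofReal_toReal hdiam]
    _ = ENNReal.ofReal (ε / 2 + D * (N * θ)) := by
        rw [← ENNReal.ofReal_mul hD0, ← ENNReal.ofReal_add (by positivity) (by positivity)]
    _ ≤ ENNReal.ofReal ε := by
        refine ENNReal.ofReal_le_ofReal ?_
        have h1 : D * (N * θ) ≤ (D * N + 1) * (ε / (2 * (D * N + 1))) := by
          rw [← mul_assoc]
          exact mul_le_mul (by linarith) (min_le_right _ _) hθ0.le (by positivity)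
        have h2 : (D * N + 1) * (ε / (2 * (D * N + 1))) = ε / 2 := by field_simp
        linarith

/-- A large compact set on which the orbits are equicontinuous contains a small piece of positive
measure, which violates sensitivity. -/
theorem exists_pos_measure_forall_besicovitchAlong_le
    (h : OnLargeCompacts μ fun M => ∀ ε : ℝ, 0 < ε → ∃ δ : ℝ, 0 < δ ∧
      ∀ x ∈ M, ∀ y ∈ M, dist x y ≤ δ → besicovitchAlong ν F x y ≤ ENNReal.ofReal ε)
    {ε : ℝ} (hε : 0 < ε) : ∃ A : Set X, MeasurableSet A ∧ 0 < μ A ∧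
      ∀ x ∈ A, ∀ y ∈ A, besicovitchAlong ν F x y ≤ ENNReal.ofReal ε := by
  obtain ⟨M, hMc, hM, hMd⟩ := h (1 / 2) (by norm_num)
  obtain ⟨δ, hδ, hδM⟩ := hMd ε hε
  have hM0 : μ M ≠ 0 := by
    intro h0
    rw [measureReal_def, h0] at hM
    norm_num at hM
  obtain ⟨t, -, htf, htc⟩ := finite_cover_balls_of_compact hMc (half_pos hδ)
  obtain ⟨i, hi⟩ : ∃ i, μ (M ∩ Metric.ball i (δ / 2)) ≠ 0 := by
    by_contra! hcon
    refine hM0 (measure_mono_null (t := ⋃ i ∈ t, M ∩ Metric.ball i (δ / 2)) (fun x hx => ?_)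
      ((measure_biUnion_null_iff htf.countable).2 fun i _ => hcon i))
    obtain ⟨i, hit, hxi⟩ := Set.mem_iUnion₂.1 (htc hx)
    exact Set.mem_iUnion₂.2 ⟨i, hit, hx, hxi⟩
  refine ⟨_, hMc.measurableSet.inter Metric.isOpen_ball.measurableSet, pos_iff_ne_zero.2 hi,
    fun x hx y hy => hδM x hx.1 y hy.1 ((dist_triangle_right x y i).trans ?_)⟩
  have h1 : dist x i < δ / 2 := hx.2
  have h2 : dist y i < δ / 2 := hy.2
  linarith

/-- The equivalence for an action of a group `G` with an averaging sequence `F`, whose continuous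
unitary characters are the functions `ch w`. -/
theorem IsAveragingSequence.tfae (hF : IsAveragingSequence ν F) (hμ : IsErgodicMeasure G μ)
    {W : Type*} {ch : W → G → ℂ} (hch : ∀ w, Continuous (ch w)) (hch1 : ∀ w j, ‖ch w j‖ = 1)
    (hall : ∀ χ : G → ℂ, Continuous χ → (∀ j, ‖χ j‖ = 1) → (∀ i j, χ (i + j) = χ i * χ j) →
      ∃ w, ∀ j, χ j = ch w j) :
    List.TFAE [
      OnLargeCompacts μ fun M => ∀ ε : ℝ, 0 < ε → ∃ δ : ℝ, 0 < δ ∧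
        ∀ x ∈ M, ∀ y ∈ M, dist x y ≤ δ → besicovitchAlong ν F x y ≤ ENNReal.ofReal ε,
      ∀ B : Set X, MeasurableSet B → OnLargeCompacts μ fun M => ∀ ε : ℝ, 0 < ε → ∃ δ : ℝ, 0 < δ ∧
        ∀ x ∈ M, ∀ y ∈ M, dist x y ≤ δ → rhoAlong ν F (B.indicator fun _ => 1) x y ≤ ε,
      ∀ f : X → ℂ, MemLp f 2 μ → OnLargeCompacts μ fun M => ∀ ε : ℝ, 0 < ε → ∃ δ : ℝ, 0 < δ ∧
        ∀ x ∈ M, ∀ y ∈ M, dist x y ≤ δ → rhoAlong ν F f x y ≤ ε,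
      ∃ (s : Set (Lp ℂ 2 μ)) (b : HilbertBasis s ℂ (Lp ℂ 2 μ)), (∀ f : s, b f = f) ∧
        ∀ f ∈ s, f ≠ 0 ∧ ∃ w, ∀ j : G, (fun x => f (j +ᵥ x)) =ᵐ[μ] fun x => ch w j * f x,
      ¬ ∃ ε : ℝ, 0 < ε ∧ ∀ A : Set X, MeasurableSet A → 0 < μ A →
        ∃ x ∈ A, ∃ y ∈ A, ENNReal.ofReal ε < besicovitchAlong ν F x y] := by
  tfae_have 4 → 3 := by
    rintro ⟨s, b, hbs, hs⟩ f hf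
    have hse : ∀ e ∈ s, IsOrbitEquicontinuous ν μ e := by
      intro e he
      obtain ⟨-, w, hw⟩ := hs e he
      exact isOrbitEquicontinuous_of_eigenfunction (Lp.memLp e) (Lp.stronglyMeasurable e) (hch w)
        (hch1 w) hw
    have hrange : Set.range b = s := by
      ext e
      refine ⟨?_, fun he => ⟨⟨e, he⟩, hbs _⟩⟩
      rintro ⟨i, rfl⟩
      rw [hbs]
      exact i.2
    have hdense : hf.toLp f ∈ closure (Submodule.span ℂ s : Set (Lp ℂ 2 μ)) := by
      rw [← Submodule.topologicalClosure_coe, ← hrange, b.dense_span]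
      trivial
    refine onLargeCompacts_forall_pos (D := fun ε x y => rhoAlong ν F f x y ≤ ε)
      (fun ε ε' x y h h' => h'.trans h) fun ε hε => ?_
    refine (hF.onLargeCompacts_densityAlong_lt hμ hse hf hdense hε).mono ?_
    rintro M ⟨δ, hδ, hM⟩
    exact ⟨δ, hδ, fun x hx y hy hxy => rhoAlong_le hε (hM x hx y hy hxy)⟩
  tfae_have 3 → 2 := fun h B hB =>
    h _ (memLp_indicator_const 2 hB 1 (Or.inr (MeasureTheory.measure_ne_top μ B)))
  tfae_have 2 → 1 := fun h =>
    onLargeCompacts_forall_pos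
      (D := fun ε x y => besicovitchAlong ν F x y ≤ ENNReal.ofReal ε)
      (fun ε ε' x y h h' => h'.trans (ENNReal.ofReal_le_ofReal h))
      fun ε hε => onLargeCompacts_besicovitchAlong_le_of_indicator h hε
  tfae_have 1 → 5 := by
    rintro h ⟨ε, hε, hs⟩
    obtain ⟨A, hA, hA0, hAε⟩ := exists_pos_measure_forall_besicovitchAlong_le h hε
    obtain ⟨x, hx, y, hy, hxy⟩ := hs A hA hA0
    exact absurd (hAε x hx y hy) (not_le.2 hxy)
  tfae_have 5 → 4 := by
    intro h
    push Not at h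
    have hU := isUnitaryRep_koopman (G := G) hμ.1
    obtain ⟨s, b, hbs, hs⟩ := hU.exists_hilbertBasis
      (hF.eq_bot_of_forall_not_eigenvector hμ h)
    refine ⟨s, b, hbs, fun f hf => ⟨(hs f hf).1, ?_⟩⟩
    obtain ⟨χ, hχc, hχ1, hχm, hχ⟩ := hU.exists_character (hs f hf).1 (hs f hf).2
    obtain ⟨w, hw⟩ := hall χ hχc hχ1 hχm
    refine ⟨w, fun j => ?_⟩
    have h1 := koopman_coeFn hμ.1 j f
    rw [hχ j] at h1
    filter_upwards [h1, Lp.coeFn_smul (χ j) f] with x hx hx'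
    rw [← hx, hx', Pi.smul_apply, smul_eq_mul, hw]
  tfae_finish

end Equivalence

/-! ### Characters of lattices and vector spaces -/

section Characters

theorem character_zero {A : Type*} [AddMonoid A] {χ : A → ℂ} (hχ1 : ∀ j, ‖χ j‖ = 1)
    (hχ : ∀ i j, χ (i + j) = χ i * χ j) : χ 0 = 1 := by
  have h := hχ 0 0
  rw [add_zero] at h
  have hne : χ 0 ≠ 0 := fun h => by simpa [h] using hχ1 0
  exact (mul_eq_left₀ hne).1 h.symm

theorem exists_character_int {χ : ℤ → ℂ} (hχ1 : ∀ j, ‖χ j‖ = 1)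
    (hχ : ∀ i j, χ (i + j) = χ i * χ j) :
    ∃ a : ℝ, ∀ t : ℤ, χ t = Complex.exp (2 * Real.pi * Complex.I * ((t • a : ℝ) : ℂ)) := by
  have h0 : χ 0 = 1 := character_zero hχ1 hχ
  obtain ⟨a, ha⟩ : ∃ a : ℝ, Complex.exp (2 * Real.pi * Complex.I * (a : ℂ)) = χ 1 := by
    refine ⟨(χ 1).arg / (2 * Real.pi), ?_⟩
    have h := Complex.norm_mul_exp_arg_mul_I (χ 1)
    rw [hχ1, Complex.ofReal_one, one_mul] at h
    refine Eq.trans ?_ h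
    congr 1
    have : (Real.pi : ℂ) ≠ 0 := by exact_mod_cast Real.pi_ne_zero
    push_cast
    field_simp
  let ψ : Multiplicative ℤ →* ℂ := ⟨⟨fun t => χ t.toAdd, h0⟩, fun i j => hχ _ _⟩
  let φ : Multiplicative ℤ →* ℂ :=
    ⟨⟨fun t => Complex.exp (2 * Real.pi * Complex.I * ((t.toAdd • a : ℝ) : ℂ)), by simp⟩,
      fun i j => by
        change Complex.exp (2 * Real.pi * Complex.I * (((i * j).toAdd • a : ℝ) : ℂ)) =
          Complex.exp (2 * Real.pi * Complex.I * ((i.toAdd • a : ℝ) : ℂ)) *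
            Complex.exp (2 * Real.pi * Complex.I * ((j.toAdd • a : ℝ) : ℂ))
        rw [← Complex.exp_add, toAdd_mul, add_smul]; congr 1; push_cast; ring⟩
  have hψφ : ψ = φ := by
    refine MonoidHom.ext_mint ?_
    change χ 1 = Complex.exp (2 * Real.pi * Complex.I * (((1 : ℤ) • a : ℝ) : ℂ))
    rw [one_smul, ha]
  exact ⟨a, fun t => DFunLike.congr_fun hψφ (Multiplicative.ofAdd t)⟩

/-- A continuous character of the real line is differentiable, because it is a multiple of the
difference of two values of its primitive; it then solves a linear differential equation. -/
theorem exists_character_real {χ : ℝ → ℂ} (hχc : Continuous χ) (hχ1 : ∀ j, ‖χ j‖ = 1)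
    (hχ : ∀ i j, χ (i + j) = χ i * χ j) :
    ∃ a : ℝ, ∀ t : ℝ, χ t = Complex.exp (2 * Real.pi * Complex.I * ((t • a : ℝ) : ℂ)) := by
  have h0 : χ 0 = 1 := character_zero hχ1 hχ
  set Φ : ℝ → ℂ := fun x => ∫ s in (0 : ℝ)..x, χ s with hΦ
  have hΦd : ∀ x, HasDerivAt Φ (χ x) x := fun x => hχc.integral_hasStrictDerivAt 0 x |>.hasDerivAt
  obtain ⟨b, hb⟩ : ∃ b, Φ b ≠ 0 := by
    by_contra! hcon
    have h1 : Φ = fun _ => 0 := funext hcon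
    have h2 := (hΦd 0)
    rw [h1] at h2
    have h3 := h2.unique (hasDerivAt_const 0 (0 : ℂ))
    rw [h0] at h3
    exact one_ne_zero h3
  have hshift : ∀ t, χ t = (Φ (t + b) - Φ t) / Φ b := by
    intro t
    rw [eq_div_iff hb]
    have h1 : χ t * Φ b = ∫ s in (0 : ℝ)..b, χ (t + s) := by
      rw [hΦ, ← intervalIntegral.integral_const_mul]
      simp_rw [hχ]
    rw [h1, intervalIntegral.integral_comp_add_left (fun s => χ s) t, add_zero]
    exact (intervalIntegral.integral_interval_sub_left (hχc.intervalIntegrable _ _)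
      (hχc.intervalIntegrable _ _)).symm
  obtain ⟨k, hk⟩ : ∃ k, HasDerivAt χ k 0 := by
    have h1 : HasDerivAt (fun t => (Φ (t + b) - Φ t) / Φ b) ((χ (0 + b) - χ 0) / Φ b) 0 :=
      (((hΦd (0 + b)).comp_add_const 0 b).sub (hΦd 0)).div_const _
    exact ⟨_, h1.congr_of_eventuallyEq (.of_forall hshift)⟩
  have hχd : ∀ t, HasDerivAt χ (χ t * k) t := by
    intro t
    have h1 : HasDerivAt (fun s => χ t * χ (s - t)) (χ t * k) t := by
      have h2 : HasDerivAt χ k (t - t) := by rwa [sub_self]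
      exact (h2.comp_sub_const t t).const_mul _
    refine h1.congr_of_eventuallyEq (.of_forall fun s => ?_)
    change χ s = χ t * χ (s - t)
    rw [← hχ, add_sub_cancel]
  have hexp : ∀ t : ℝ, χ t = Complex.exp (t * k) := by
    have h1 : ∀ t : ℝ, HasDerivAt (fun s : ℝ => χ s * Complex.exp (-(s * k))) 0 t := by
      intro t
      have h2 : HasDerivAt (fun s : ℝ => (s : ℂ) * k) (1 * k) t :=
        (Complex.ofRealCLM.hasDerivAt (x := t)).mul_const k
      refine ((hχd t).mul h2.neg.cexp).congr_deriv ?_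
      ring
    intro t
    have h3 := is_const_of_deriv_eq_zero (fun s => (h1 s).differentiableAt)
      (fun s => (h1 s).deriv) t 0
    simp only [h0, Complex.ofReal_zero, zero_mul, neg_zero, Complex.exp_zero, mul_one] at h3
    rw [Complex.exp_neg] at h3
    exact (mul_inv_eq_one₀ (Complex.exp_ne_zero _)).1 h3
  -- the values have modulus one, so the exponent is imaginary
  have hre : k.re = 0 := by
    have h1 := hχ1 1
    rw [hexp, Complex.norm_exp, Complex.ofReal_one, one_mul, Real.exp_eq_one_iff] at h1
    exact h1
  refine ⟨k.im / (2 * Real.pi), fun t => ?_⟩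
  rw [hexp]
  congr 1
  have hk : k = k.im * Complex.I := Complex.ext (by simp [hre]) (by simp)
  have hpi : (Real.pi : ℂ) ≠ 0 := by exact_mod_cast Real.pi_ne_zero
  rw [smul_eq_mul]
  push_cast
  field_simp
  conv_lhs => rw [hk]
  ring

/-- The character of `R^d` with frequency `w`. -/
noncomputable def expChar (R : Type) [SMul R ℝ] (d : ℕ) (w : Fin d → ℝ) (j : Fin d → R) : ℂ :=
  Complex.exp (2 * Real.pi * Complex.I * ((∑ i, j i • w i : ℝ) : ℂ))

theorem norm_expChar (R : Type) [SMul R ℝ] (d : ℕ) (w : Fin d → ℝ) (j : Fin d → R) :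
    ‖expChar R d w j‖ = 1 := by
  have h : 2 * Real.pi * Complex.I * ((∑ i, j i • w i : ℝ) : ℂ) =
      ((2 * Real.pi * ∑ i, j i • w i : ℝ) : ℂ) * Complex.I := by push_cast; ring
  rw [expChar, h, Complex.norm_exp_ofReal_mul_I]

/-- If the characters of `R` are exponentials, then so are the characters of `R^d`. -/
theorem exists_eq_expChar {R : Type} [AddCommGroup R] [TopologicalSpace R] [SMul R ℝ]
    (hR : ∀ χ : R → ℂ, Continuous χ → (∀ j, ‖χ j‖ = 1) → (∀ i j, χ (i + j) = χ i * χ j) →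
      ∃ a : ℝ, ∀ t : R, χ t = Complex.exp (2 * Real.pi * Complex.I * ((t • a : ℝ) : ℂ)))
    {d : ℕ} {χ : (Fin d → R) → ℂ} (hχc : Continuous χ) (hχ1 : ∀ j, ‖χ j‖ = 1)
    (hχ : ∀ i j, χ (i + j) = χ i * χ j) : ∃ w, ∀ j, χ j = expChar R d w j := by
  have h0 : χ 0 = 1 := character_zero hχ1 hχ
  choose w hw using fun i : Fin d => hR (fun t => χ (Pi.single i t))
    (hχc.comp (continuous_single (A := fun _ : Fin d => R) i)) (fun t => hχ1 _)
    (fun s t => by rw [Pi.single_add, hχ])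
  refine ⟨w, fun j => ?_⟩
  have hsum : ∀ s : Finset (Fin d), χ (∑ i ∈ s, Pi.single i (j i)) =
      Complex.exp (∑ i ∈ s, 2 * Real.pi * Complex.I * ((j i • w i : ℝ) : ℂ)) := by
    intro s
    induction s using Finset.induction_on with
    | empty => simp [h0]
    | insert i s hi ih => rw [Finset.sum_insert hi, Finset.sum_insert hi, hχ, ih, hw,
        Complex.exp_add]
  have h1 := hsum Finset.univ
  rw [Finset.univ_sum_single] at h1
  rw [h1, expChar, ← Finset.mul_sum, Complex.ofReal_sum]

end Characters

/-! ### Cubes as averaging sequences -/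

section Cubes

/-- Cubes form an averaging sequence if the measure of a box in `R^d` is the product of the lengths
of its sides, up to a constant `c` added to every length. Here `ι` is the embedding of `R`
into the real numbers. -/
theorem isAveragingSequence_cube {R : Type} [NormedCommRing R] [LinearOrder R]
    [OrderClosedTopology R] [MeasurableSpace R] [BorelSpace R] [SecondCountableTopology R]
    (ι : R →+* ℝ) (hι : ∀ a b, a ≤ b ↔ ι a ≤ ι b) (hnorm : ∀ a, ‖a‖ = |ι a|) {d : ℕ}
    (ν : Measure (Fin d → R)) {c : ℝ} (hc : 0 ≤ c)
    (hvol : ∀ a b : Fin d → R, ν (Set.Icc a b) = ∏ i, ENNReal.ofReal (ι (b i) - ι (a i) + c)) :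
    IsAveragingSequence ν (cube R d) := by
  have hcube : ∀ n : ℕ, ν (cube R d n) = ENNReal.ofReal (n + c) ^ d := by
    intro n
    rw [cube, hvol]
    simp
  refine ⟨fun n => measurableSet_Icc, fun n j hj => ?_, fun n hn => ?_, fun g => ?_,
    ⟨ENNReal.ofReal 10 ^ d, by finiteness, fun n => ?_⟩⟩
  · rw [mem_closedBall_zero_iff, pi_norm_le_iff_of_nonneg (Nat.cast_nonneg n)]
    intro i
    have h1 : ι 0 ≤ ι (j i) := (hι _ _).1 (hj.1 i)
    have h2 : ι (j i) ≤ ι (n : R) := (hι _ _).1 (hj.2 i)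
    rw [map_zero] at h1
    rw [map_natCast] at h2
    rwa [hnorm, abs_of_nonneg h1]
  · rw [hcube]
    have : (0 : ℝ) < n := by exact_mod_cast Nat.pos_of_ne_zero hn
    exact pow_ne_zero _ (ENNReal.ofReal_pos.2 (by linarith)).ne'
  · -- the points of `F n` at distance at least `K ≥ ‖g‖` from the boundary are not moved out
    obtain ⟨K, hK⟩ := exists_nat_ge ‖g‖
    have hgi : ∀ i, |ι (g i)| ≤ K := fun i => by
      rw [← hnorm]; exact (norm_le_pi_norm g i).trans hK
    set B : ℕ → Set (Fin d → R) := fun n =>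
      Set.Icc (fun _ => (K : R)) (fun _ => (n : R) - (K : R)) with hB
    have hBvol : ∀ n, ν (B n) = ENNReal.ofReal (n - 2 * K + c) ^ d := by
      intro n
      simp only [hB, hvol, map_sub, map_natCast, Finset.prod_const, Finset.card_univ,
        Fintype.card_fin]
      congr 2
      ring
    have hBsub : ∀ n, B n ⊆ cube R d n ∩ (fun j => j + g) ⁻¹' cube R d n := by
      intro n j hj
      have h1 : ∀ i, (K : ℝ) ≤ ι (j i) := fun i => by
        simpa using (hι _ _).1 (hj.1 i)
      have h2 : ∀ i, ι (j i) ≤ n - K := fun i => by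
        simpa using (hι _ _).1 (hj.2 i)
      have hK0 : (0 : ℝ) ≤ K := Nat.cast_nonneg K
      refine ⟨⟨fun i => (hι _ _).2 ?_, fun i => (hι _ _).2 ?_⟩,
        ⟨fun i => (hι _ _).2 ?_, fun i => (hι _ _).2 ?_⟩⟩ <;>
        · have := abs_le.1 (hgi i)
          have := h1 i
          have := h2 i
          simp only [Pi.zero_apply, Pi.add_apply, map_zero, map_add, map_natCast]
          linarith
    have hfin : ∀ n, ν (cube R d n) ≠ ∞ := fun n => by rw [hcube]; finiteness
    have hle : ∀ᶠ n : ℕ in atTop, ν (cube R d n \ (fun j => j + g) ⁻¹' cube R d n) /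
        ν (cube R d n) ≤ 1 - ENNReal.ofReal (1 - 2 * K / (n + c)) ^ d := by
      filter_upwards [eventually_gt_atTop 0] with n hn
      have hn' : (0 : ℝ) < n := by exact_mod_cast hn
      have hpos : 0 < (n : ℝ) + c := by linarith
      have h0 : ν (cube R d n) ≠ 0 := by
        rw [hcube]; exact pow_ne_zero _ (ENNReal.ofReal_pos.2 hpos).ne'
      have hsub : ν (cube R d n \ (fun j => j + g) ⁻¹' cube R d n) ≤
          ν (cube R d n) - ν (B n) := by
        rw [← measure_sdiff ((hBsub n).trans Set.inter_subset_left)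
          measurableSet_Icc.nullMeasurableSet
          (measure_ne_top_of_subset ((hBsub n).trans Set.inter_subset_left) (hfin n))]
        exact measure_mono fun j hj => ⟨hj.1, fun hjB => hj.2 (hBsub n hjB).2⟩
      refine (ENNReal.div_le_div_right hsub _).trans ?_
      rw [ENNReal.sub_div (fun _ _ => h0), ENNReal.div_self h0 (hfin n)]
      refine tsub_le_tsub_left (le_of_eq ?_) _
      rw [hBvol, hcube, ENNReal.div_eq_inv_mul, ENNReal.inv_pow, ← mul_pow,
        ← ENNReal.div_eq_inv_mul, ← ENNReal.ofReal_div_of_pos hpos]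
      congr 2
      field_simp
      ring
    have hlim : Tendsto (fun n : ℕ => 1 - ENNReal.ofReal (1 - 2 * K / (n + c)) ^ d) atTop
        (𝓝 0) := by
      have h1 : Tendsto (fun n : ℕ => 1 - 2 * (K : ℝ) / (n + c)) atTop (𝓝 (1 - 0)) :=
        tendsto_const_nhds.sub (tendsto_const_nhds.div_atTop
          (tendsto_atTop_add_const_right _ _ tendsto_natCast_atTop_atTop))
      have h2 := ENNReal.Tendsto.sub (tendsto_const_nhds (x := (1 : ℝ≥0∞)))
        (ENNReal.Tendsto.pow (n := d) (ENNReal.tendsto_ofReal h1)) (Or.inl ENNReal.one_ne_top)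
      simpa using h2
    exact tendsto_of_tendsto_of_tendsto_of_le_of_le' tendsto_const_nhds hlim
      (.of_forall fun _ => zero_le) hle
  · -- the ball of radius `5 * n` lies in a cube of side `10 * n`
    have hn0 : (0 : ℝ) ≤ n := Nat.cast_nonneg n
    have hsub : Metric.closedBall (0 : Fin d → R) (5 * (n : ℝ)) ⊆
        Set.Icc (fun _ => -(5 * (n : R))) (fun _ => 5 * (n : R)) := by
      intro j hj
      rw [mem_closedBall_zero_iff, pi_norm_le_iff_of_nonneg (by positivity)] at hj
      refine ⟨fun i => (hι _ _).2 ?_, fun i => (hι _ _).2 ?_⟩ <;>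
        · have h := hj i
          rw [hnorm, abs_le] at h
          simp only [map_neg, map_mul, map_natCast, map_ofNat]
          linarith [h.1, h.2]
    refine (measure_mono hsub).trans ?_
    rw [hvol, hcube, ← mul_pow, ← ENNReal.ofReal_mul (by norm_num)]
    simp only [map_neg, map_mul, map_natCast, map_ofNat, Finset.prod_const, Finset.card_univ,
      Fintype.card_fin]
    gcongr
    linarith

theorem isAveragingSequence_cube_int (d : ℕ) :
    IsAveragingSequence (Measure.count : Measure (Fin d → ℤ)) (cube ℤ d) := by
  refine isAveragingSequence_cube (Int.castRingHom ℝ) (fun a b => by simp) (fun a => rfl) _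
    zero_le_one fun a b => ?_
  have h1 : Set.Icc a b = ((Finset.Icc a b : Finset (Fin d → ℤ)) : Set (Fin d → ℤ)) := by simp
  rw [h1, Measure.count_apply_finset, Pi.card_Icc]
  push_cast
  refine Finset.prod_congr rfl fun i _ => ?_
  rw [Int.card_Icc]
  have h2 : (((b i + 1 - a i).toNat : ℕ) : ℝ≥0∞) =
      ENNReal.ofReal (((b i + 1 - a i).toNat : ℕ) : ℝ) := by simp
  rw [h2]
  rcases le_total 0 (b i + 1 - a i) with h | h
  · congr 1
    have h3 : (((b i + 1 - a i).toNat : ℤ) : ℝ) = ((b i + 1 - a i : ℤ) : ℝ) := by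
      rw [Int.toNat_of_nonneg h]
    rw [← Int.cast_natCast, h3]
    push_cast
    simp
    ring
  · rw [Int.toNat_of_nonpos h, Nat.cast_zero, ENNReal.ofReal_zero, eq_comm,
      ENNReal.ofReal_eq_zero]
    have h3 : ((b i + 1 - a i : ℤ) : ℝ) ≤ 0 := by exact_mod_cast h
    push_cast at h3
    simp
    linarith

theorem isAveragingSequence_cube_real (d : ℕ) :
    IsAveragingSequence (volume : Measure (Fin d → ℝ)) (cube ℝ d) :=
  isAveragingSequence_cube (RingHom.id ℝ) (fun a b => Iff.rfl) (fun a => rfl) _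
    le_rfl fun a b => by simp [Real.volume_Icc_pi]

instance isAddHaarMeasure_count_int (d : ℕ) :
    (Measure.count : Measure (Fin d → ℤ)).IsAddHaarMeasure where
  lt_top_of_isCompact {K} hK := Measure.count_apply_lt_top.2 hK.finite_of_discrete
  open_pos U _ hU := by
    rw [Measure.count_ne_zero_iff]
    exact hU

end Cubes

end MeanEquicontinuity

theorem mainTheorem1 (d : ℕ) {X : Type*} [MetricSpace X] [CompactSpace X]
    [MeasurableSpace X] [BorelSpace X] (μ : Measure X) [IsProbabilityMeasure μ] :
    (∀ [AddAction (Fin d → ℤ) X] [ContinuousVAdd (Fin d → ℤ) X],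
      MeanEquicontinuity.IsErgodicMeasure (Fin d → ℤ) μ →
      List.TFAE [
        MeanEquicontinuity.MuMeanEquicontinuous
          (Measure.count : Measure (Fin d → ℤ)) μ,
        ∀ B : Set X, MeasurableSet B → MeanEquicontinuity.MuFunMeanEquicontinuous
          (Measure.count : Measure (Fin d → ℤ)) μ (B.indicator fun _ => 1),
        ∀ f : X → ℂ, MemLp f 2 μ → MeanEquicontinuity.MuFunMeanEquicontinuous
          (Measure.count : Measure (Fin d → ℤ)) μ f,
        MeanEquicontinuity.HasDiscreteSpectrum ℤ d μ,
        ¬ MeanEquicontinuity.MuMeanSensitive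
          (Measure.count : Measure (Fin d → ℤ)) μ]) ∧
    (∀ [AddAction (Fin d → ℝ) X] [ContinuousVAdd (Fin d → ℝ) X],
      MeanEquicontinuity.IsErgodicMeasure (Fin d → ℝ) μ →
      List.TFAE [
        MeanEquicontinuity.MuMeanEquicontinuous
          (volume : Measure (Fin d → ℝ)) μ,
        ∀ B : Set X, MeasurableSet B → MeanEquicontinuity.MuFunMeanEquicontinuous
          (volume : Measure (Fin d → ℝ)) μ (B.indicator fun _ => 1),
        ∀ f : X → ℂ, MemLp f 2 μ → MeanEquicontinuity.MuFunMeanEquicontinuous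
          (volume : Measure (Fin d → ℝ)) μ f,
        MeanEquicontinuity.HasDiscreteSpectrum ℝ d μ,
        ¬ MeanEquicontinuity.MuMeanSensitive
          (volume : Measure (Fin d → ℝ)) μ]) := by
  refine ⟨fun hμ => ?_, fun hμ => ?_⟩
  · exact (MeanEquicontinuity.isAveragingSequence_cube_int d).tfae hμ
      (ch := MeanEquicontinuity.expChar ℤ d)
      (fun w => continuous_of_discreteTopology)
      (MeanEquicontinuity.norm_expChar ℤ d)
      fun χ hχc hχ1 hχ => MeanEquicontinuity.exists_eq_expChar
        (fun _ _ h1 h => MeanEquicontinuity.exists_character_int h1 h) hχc hχ1 hχ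
  · exact (MeanEquicontinuity.isAveragingSequence_cube_real d).tfae hμ
      (ch := MeanEquicontinuity.expChar ℝ d)
      (fun w => by unfold MeanEquicontinuity.expChar; fun_prop)
      (MeanEquicontinuity.norm_expChar ℝ d)
      fun χ hχc hχ1 hχ => MeanEquicontinuity.exists_eq_expChar
        (fun _ hc h1 h => MeanEquicontinuity.exists_character_real hc h1 h) hχc hχ1 hχ
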